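/- **Conventions.** $|\cdot|$ is the Euclidean norm on $\mathbb R^N$, $d(\cdot,\cdot)$ the Euclidean distance, all balls $B(x,t)$ are closed, $\omega_n$ is the volume of the unit ball of $\mathbb R^n$, an $n$-plane is an $n$-dimensional affine subspace of $\mathbb R^N$, and $\varangle(P,P')$ is the operator norm of the difference of the orthogonal projections onto the linear subspaces parallel to $P,P'$. An $(n,\sigma)$-simplex is a nondegenerate simplex with vertices $x_0,\dots,x_n$ such that each $x_i$ has distance at least $\sigma$ from the affine hull of the other vertices. **Integrands.** Let $1\le n<N$, $p>1$, $\mathcal K:(\mathbb R^N)^{n+2}\to[0,\infty)$ and let $\mu$ be a Borel measure on $\mathbb R^N$. $\mathcal K^p$ is a symmetric $\mu$-proper integrand if $\mathcal K$ is symmetric and $\mu^{n+2}$-measurable; there are $c,l\ge1$ such that for all $t>0$, $C\ge1$, $x\in\mathbb R^N$, all $(n,t/C)$-simplices with vertices $x_0,\dots,x_n\in B(x,Ct)$ and all $w\in B(x,Ct)$ one has $\big(d(w,\mathrm{aff}(x_0,\dots,x_n))/t\big)^p\le c\,C^l\,t^{n(n+1)}\mathcal K^p(x_0,\dots,x_n,w)$;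 $t^{n(n+1)}\mathcal K^p(tx_0,\dots,tx_{n+1})=\mathcal K^p(x_0,\dots,x_{n+1})$ for $t>0$; and $\mathcal K$ is invariant under simultaneous translation of its arguments. Put $\mathcal M_{\mathcal K^p}(\mu)=\int\!\cdots\!\int\mathcal K^p\,d\mu\cdots d\mu$. **Setting.** Let $C_0\ge10$, $k>2$, $0<\eta\le\omega_n2^{-(2n+2)}$, let $P_0\subset\mathbb R^N$ be an $n$-dimensional linear subspace, and let $\mu$ be a Borel measure on $\mathbb R^N$ with compact support $F$ such that $\mathcal K^p$ is a symmetric $\mu$-proper integrand and (A) $\mu(B(0,5))\ge1$, $\mu(\mathbb R^N\setminus B(0,5))=0$; (B) $\mu(B)\le C_0(\operatorname{diam}B)^n$ for every ball $B$; (C) $\mathcal M_{\mathcal K^p}(\mu)\le\eta$; (D) $\beta^{P_0}(0,5)\le\eta$, where $\beta^P(x,t)=t^{-n}\int_{B(x,kt)}\frac{d(y,P)}{t}\,d\mu(y)$ and $\beta(x,t)=\inf_P\beta^P(x,t)$ over all $n$-planes $P$. Let $N_0=N_0(N)$ be a constant for which Besicovitch's covering theorem holds in $\mathbb R^N$ (every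 family of nondegenerate closed balls of bounded diameter has $N_0$ countable subfamilies, each consisting of disjoint balls, that together cover all the centres) and $\delta=\min\{10^{-10}/(600^nN_0),\,2/50^n\}$. Let $\alpha,\varepsilon>0$ with $\eta\le2\varepsilon$. **Construction.** Let $S_{total}$ be the set of $(x,t)\in F\times(0,50)$ with $\mu(B(x,t))\ge\frac\delta2t^n$, $\beta(x,t)<2\varepsilon$ and for which there is an $n$-plane $P_{(x,t)}$ with $\beta^{P_{(x,t)}}(x,t)\le2\varepsilon$ and $\varangle(P_{(x,t)},P_0)\le\alpha$; fix such planes. For $x\in F$ let $h(x)$ be the supremum of $0$ and all $t\in(0,50)$ for which there are $y\in F$ and $\tau\in[\frac t4,\frac t3]$ with $d(x,y)<\frac\tau3$ and $(y,\tau)\notin S_{total}$. Let $S=\{(x,t)\in S_{total}: t\ge h(x)\}$ and $\mathcal Z=\{x\in F:h(x)=0\}$. Let $\pi,\pi^\perp$ be the orthogonal projections onto $P_0$ and $P_0^\perp$, and put $d(x)=\inf_{(X,t)\in S}(d(X,x)+t)$ for $x\in\mathbb R^N$ and $D(y)=\inf_{\pi(x)=y}d(x)$ for $y\in P_0$. Fix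 orthonormal coordinates on $P_0$ and consider the associated (half-open) dyadic cells; $rQ$ denotes the cube with the same centre and orientation as $Q$ and $r$ times its diameter. Let $\{R_i\}_{i\in I}$ be the family of distinct cells that are, for some $z\in P_0$ with $D(z)>0$, the largest dyadic cell $Q\ni z$ with $\operatorname{diam}Q\le\frac1{20}\inf_QD$. Let $U_{12}=B(0,12)\cap P_0$ and $I_{12}=\{i\in I:R_i\cap U_{12}\ne\emptyset\}$. For $i\in I_{12}$ fix a ball $B_i=B(X_i,t_i)$ with $(X_i,t_i)\in S$, $\operatorname{diam}R_i\le\operatorname{diam}B_i\le200\operatorname{diam}R_i$ and $d(\pi(B_i),R_i)\le100\operatorname{diam}R_i$, let $P_i=P_{(X_i,t_i)}$, and let $A_i:P_0\to P_0^\perp$ be the affine map with graph $P_i$. Fix smooth functions $\phi_i$ ($i\in I_{12}$) on $U_{12}\setminus\pi(\mathcal Z)$ with $0\le\phi_i\le1$, $\phi_i=0$ outside $3R_i$ and $\sum_{i\in I_{12}}\phi_i=1$ on $U_{12}\setminus\pi(\mathcal Z)$. Define $A:U_{12}\to P_0^\perp$ by $A(a)=\pi^\perp\big((\pi|_{\mathcal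 Z})^{-1}(a)\big)$ for $a\in\pi(\mathcal Z)$ and $A(a)=\sum_{i\in I_{12}}\phi_i(a)A_i(a)$ for $a\in U_{12}\setminus\pi(\mathcal Z)$. With $K=2(104\cdot10\cdot6+214)$, let $$G=\{x\in F\setminus\mathcal Z:\ x\notin B(X_i,Kt_i)\text{ for all }i\in I_{12}\text{ with }\pi(x)\in3R_i\}\cup\{x\in F\setminus\mathcal Z:\ \pi(x)\in\pi(\mathcal Z)\},$$ $$\tilde F=\{x\in F\setminus G:\ d(x,\pi(x)+A(\pi(x)))\le\varepsilon^{1/2}d(x)\}.$$ **Theorem.** There are an absolute constant $\tilde k\ge4$, a number $\hat\varepsilon=\hat\varepsilon(N,n,C_0)\in(0,\frac14]$ and a constant $C_5=C_5(N,n,\mathcal K,p,C_0)$ (once $N_0=N_0(N)$ is fixed) such that, whenever $0<\alpha\le\frac14$, $\eta<2\hat\varepsilon$, $k\ge\tilde k$ and $\varepsilon\in[\frac\eta2,\hat\varepsilon)$, every outcome of the construction above satisfies $$\mu(F\setminus\tilde F)\le C_5\,\varepsilon^{1/2}.$$ -/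

import Mathlib

open MeasureTheory Set Metric
open scoped ENNReal NNReal ContDiff

noncomputable section

namespace MengerGraph

/-- `ℝ^N` with the Euclidean norm. -/
abbrev Euc (N : ℕ) := EuclideanSpace ℝ (Fin N)

/-! ### Constants, planes, angles, simplices -/

/-- `m` is a constant for which Besicovitch's covering theorem holds in `ℝ^N`: from every family
of nondegenerate closed balls (encoded as pairs of centre and radius) with bounded diameters one
can choose `m` countable subfamilies, each consisting of disjoint balls, which together cover the
set of all centres. -/
def IsBesicovitchConst (N m : ℕ) : Prop :=
  ∀ 𝓕 : Set (Euc N × ℝ), (∀ q ∈ 𝓕, 0 < q.2) → (∃ R : ℝ, ∀ q ∈ 𝓕, q.2 ≤ R) →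
    ∃ 𝓑 : Fin m → Set (Euc N × ℝ),
      (∀ i, 𝓑 i ⊆ 𝓕 ∧ (𝓑 i).Countable ∧
        (𝓑 i).PairwiseDisjoint fun q => closedBall q.1 q.2) ∧
      Prod.fst '' 𝓕 ⊆ ⋃ i, ⋃ q ∈ 𝓑 i, closedBall q.1 q.2

/-- Besicovitch's covering theorem: such a constant exists in every dimension. -/
theorem exists_isBesicovitchConst (N : ℕ) : ∃ m, IsBesicovitchConst N m := by
  refine ⟨Besicovitch.multiplicity (Euc N), ?_⟩
  rintro 𝓕 hpos ⟨R, hR⟩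
  obtain ⟨s, hs, hcov⟩ := Besicovitch.exist_disjoint_covering_families
    (Besicovitch.one_lt_goodτ (Euc N))
    (Besicovitch.isEmpty_satelliteConfig_multiplicity (Euc N))
    (⟨fun q : 𝓕 => q.1.1, fun q : 𝓕 => q.1.2, fun q => hpos q.1 q.2, R,
      fun q => hR q.1 q.2⟩ : Besicovitch.BallPackage 𝓕 (Euc N))
  have hdisj : ∀ i, ((fun q : 𝓕 => (q : Euc N × ℝ)) '' s i).PairwiseDisjoint
      fun q => closedBall q.1 q.2 := by
    rintro i _ ⟨q, hq, rfl⟩ _ ⟨q', hq', rfl⟩ hne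
    exact hs i hq hq' (fun h => hne (by rw [h]))
  refine ⟨fun i => (fun q : 𝓕 => (q : Euc N × ℝ)) '' s i, fun i => ⟨?_, ?_, hdisj i⟩, ?_⟩
  · rintro _ ⟨q, _, rfl⟩
    exact q.2
  · refine (hdisj i).countable_of_nonempty_interior ?_
    rintro _ ⟨q, _, rfl⟩
    exact ⟨q.1.1, ball_subset_interior_closedBall (mem_ball_self (hpos q.1 q.2))⟩
  · rintro _ ⟨q, hq, rfl⟩
    have h := hcov ⟨⟨q, hq⟩, rfl⟩
    simp only [mem_iUnion] at h ⊢
    obtain ⟨i, j, hj, hx⟩ := h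
    exact ⟨i, j.1, ⟨j, hj, rfl⟩, ball_subset_closedBall hx⟩

/-- `ω_n`, the volume of the unit ball of `ℝ^n`. -/
def unitBallVolume (n : ℕ) : ℝ := volume.real (closedBall (0 : Euc n) 1)

/-- `P` is an `n`-dimensional affine subspace. -/
def IsPlane {N : ℕ} (n : ℕ) (P : AffineSubspace ℝ (Euc N)) : Prop :=
  (P : Set (Euc N)).Nonempty ∧ Module.finrank ℝ P.direction = n

/-- The angle between two linear subspaces: the operator norm of the difference of the
orthogonal projections. The angle between affine planes is that between their directions. -/
def angle {N : ℕ} (V W : Submodule ℝ (Euc N)) : ℝ := ‖V.starProjection - W.starProjection‖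

/-- `Δ(x_0,…,x_m)` is an `(m,σ)`-simplex: a nondegenerate simplex in which the distance of each
vertex to the affine hull of the other ones is at least `σ`. -/
def IsFatSimplex {N m : ℕ} (σ : ℝ) (x : Fin (m + 1) → Euc N) : Prop :=
  AffineIndependent ℝ x ∧
    ∀ i, σ ≤ infDist (x i) (affineSpan ℝ (x '' {i}ᶜ) : Set (Euc N))

/-- `𝓚^p` is a `μ`-proper integrand. -/
structure IsProperIntegrand {N : ℕ} (n : ℕ) (p : ℝ) (𝓚 : (Fin (n + 2) → Euc N) → ℝ≥0)
    (μ : Measure (Euc N)) : Prop where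
  aemeasurable : AEMeasurable 𝓚 (Measure.pi fun _ => μ)
  lower_bound : ∃ c l : ℝ, 1 ≤ c ∧ 1 ≤ l ∧
    ∀ (t C : ℝ) (x : Euc N) (y : Fin (n + 1) → Euc N), 0 < t → 1 ≤ C →
      IsFatSimplex (t / C) y → (∀ i, y i ∈ closedBall x (C * t)) →
      ∀ w ∈ closedBall x (C * t),
        (infDist w (affineSpan ℝ (range y) : Set (Euc N)) / t) ^ p ≤
          c * C ^ l * t ^ (n * (n + 1)) * (𝓚 (Fin.snoc (α := fun _ => Euc N) y w) : ℝ) ^ p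
  homogeneous : ∀ (t : ℝ) (x : Fin (n + 2) → Euc N), 0 < t →
    t ^ (n * (n + 1)) * (𝓚 (fun i => t • x i) : ℝ) ^ p = (𝓚 x : ℝ) ^ p
  translation : ∀ (b : Euc N) (x : Fin (n + 2) → Euc N), 𝓚 (fun i => x i + b) = 𝓚 x

/-- The integrand is symmetric in all its arguments. -/
def IsSymmetric {N n : ℕ} (𝓚 : (Fin (n + 2) → Euc N) → ℝ≥0) : Prop :=
  ∀ (σ : Equiv.Perm (Fin (n + 2))) (x : Fin (n + 2) → Euc N), 𝓚 (x ∘ σ) = 𝓚 x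

/-- The integral Menger curvature `𝓜_{𝓚^p}(μ)`. -/
def mengerCurvature {N n : ℕ} (p : ℝ) (𝓚 : (Fin (n + 2) → Euc N) → ℝ≥0)
    (μ : Measure (Euc N)) : ℝ≥0∞ :=
  ∫⁻ x, (𝓚 x : ℝ≥0∞) ^ p ∂(Measure.pi fun _ => μ)

/-- The measure quotient `δ(B(x,t)) = μ(B(x,t)) / t^n`. -/
def density {N : ℕ} (n : ℕ) (μ : Measure (Euc N)) (x : Euc N) (t : ℝ) : ℝ :=
  μ.real (closedBall x t) / t ^ n

/-- `β_{1;k;μ}^P(x,t) = t^{-n} ∫_{B(x,kt)} d(y,P)/t dμ(y)`. -/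
def betaPlane {N : ℕ} (n : ℕ) (μ : Measure (Euc N)) (k : ℝ) (P : AffineSubspace ℝ (Euc N))
    (x : Euc N) (t : ℝ) : ℝ≥0∞ :=
  (∫⁻ y in closedBall x (k * t), ENNReal.ofReal (infDist y (P : Set (Euc N)) / t) ∂μ) /
    ENNReal.ofReal (t ^ n)

/-- `β_{1;k;μ}(x,t)`, the infimum of `β_{1;k;μ}^P(x,t)` over all `n`-planes `P`. -/
def beta {N : ℕ} (n : ℕ) (μ : Measure (Euc N)) (k : ℝ) (x : Euc N) (t : ℝ) : ℝ≥0∞ :=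
  ⨅ (P : AffineSubspace ℝ (Euc N)) (_ : IsPlane n P), betaPlane n μ k P x t

/-- The parameters on which the construction depends: the measure `μ`, the linear subspace `P₀`,
the constant `N₀` of Besicovitch's theorem, and the numbers `k`, `α`, `ε`. -/
structure Config (n N : ℕ) where
  μ : Measure (Euc N)
  P₀ : Submodule ℝ (Euc N)
  N₀ : ℕ
  k : ℝ
  α : ℝ
  ε : ℝ

namespace Config

variable {n N : ℕ} (c : Config n N)

/-- The standing assumptions of the construction on the measure `μ` and the plane `P₀`. -/
structure Standing (p : ℝ) (𝓚 : (Fin (n + 2) → Euc N) → ℝ≥0) (C₀ η : ℝ) : Prop where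
  finrank_P₀ : Module.finrank ℝ c.P₀ = n
  η_pos : 0 < η
  η_le : η ≤ unitBallVolume n / 2 ^ (2 * n + 2)
  isCompact_support : IsCompact c.μ.support
  proper : IsProperIntegrand n p 𝓚 c.μ
  symmetric : IsSymmetric 𝓚
  one_le_measure : 1 ≤ c.μ (closedBall 0 5)
  measure_compl : c.μ (closedBall 0 5)ᶜ = 0
  -- the diameter of `closedBall x r` is `2 * r`
  upper_regular : ∀ (x : Euc N) (r : ℝ), 0 < r →
    c.μ (closedBall x r) ≤ ENNReal.ofReal (C₀ * (2 * r) ^ n)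
  curvature_le : mengerCurvature p 𝓚 c.μ ≤ ENNReal.ofReal η
  beta_le : betaPlane n c.μ c.k c.P₀.toAffineSubspace 0 5 ≤ ENNReal.ofReal η

/-! ### The sets `F`, `S_total`, `S`, `𝒵` and the functions `h`, `d`, `D` -/

/-- The support of `μ`. -/
def F : Set (Euc N) := c.μ.support

/-- The constant `δ`. -/
def δ : ℝ := min ((10 : ℝ)⁻¹ ^ 10 / (600 ^ n * c.N₀)) (2 / 50 ^ n)

/-- `P` is an `n`-plane with `β_{1;k}^P(x,t) ≤ 2ε` and angle at most `α` with `P₀`. -/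
def GoodPlane (x : Euc N) (t : ℝ) (P : AffineSubspace ℝ (Euc N)) : Prop :=
  IsPlane n P ∧ betaPlane n c.μ c.k P x t ≤ ENNReal.ofReal (2 * c.ε) ∧
    angle P.direction c.P₀ ≤ c.α

def Stotal : Set (Euc N × ℝ) :=
  {q | q.1 ∈ c.F ∧ q.2 ∈ Ioo (0 : ℝ) 50 ∧ c.δ / 2 ≤ density n c.μ q.1 q.2 ∧
    beta n c.μ c.k q.1 q.2 < ENNReal.ofReal (2 * c.ε) ∧ ∃ P, c.GoodPlane q.1 q.2 P}

def H (x : Euc N) : Set ℝ :=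
  {t | t ∈ Ioo (0 : ℝ) 50 ∧ ∃ y ∈ c.F, ∃ τ : ℝ, t / 4 ≤ τ ∧ τ ≤ t / 3 ∧
    dist x y < τ / 3 ∧ (y, τ) ∉ c.Stotal}

def h (x : Euc N) : ℝ := sSup (c.H x ∪ {0})

def S : Set (Euc N × ℝ) := {q | q ∈ c.Stotal ∧ c.h q.1 ≤ q.2}

def Z : Set (Euc N) := {x | x ∈ c.F ∧ c.h x = 0}

/-- The orthogonal projection `π` onto `P₀`. -/
def proj (x : Euc N) : c.P₀ := c.P₀.orthogonalProjectionOnto x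

/-- The orthogonal projection `π^⊥` onto the orthogonal complement of `P₀`. -/
def projPerp (x : Euc N) : c.P₀ᗮ := c.P₀ᗮ.orthogonalProjectionOnto x

/-- `d(x) = inf_{(X,t) ∈ S} (d(X,x) + t)`. -/
def d (x : Euc N) : ℝ := sInf ((fun q : Euc N × ℝ => dist q.1 x + q.2) '' c.S)

/-- `D(y) = inf_{x ∈ π⁻¹(y)} d(x)`. -/
def D (y : c.P₀) : ℝ := sInf (c.d '' (c.proj ⁻¹' {y}))

end Config

/-! ### Dyadic cells -/

/-- A dyadic cell of side length `2 ^ level` in `n` dimensions. -/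
structure Cell (n : ℕ) where
  level : ℤ
  pos : Fin n → ℤ

namespace Cell

variable {n N : ℕ} {V : Submodule ℝ (Euc N)}

/-- The cube with the same centre and orientation as the given dyadic cell but `r` times its
diameter, as a subset of the subspace `V` with the coordinates of an orthonormal basis `b`. -/
def scaled (b : OrthonormalBasis (Fin n) ℝ V) (r : ℝ) (Q : Cell n) : Set V :=
  {y | ∀ j, b.repr y j ∈ Ico (((Q.pos j : ℝ) + 1 / 2 - r / 2) * 2 ^ Q.level)
    (((Q.pos j : ℝ) + 1 / 2 + r / 2) * 2 ^ Q.level)}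

/-- The dyadic cell itself, `{y | pos j * 2 ^ level ≤ y j < (pos j + 1) * 2 ^ level}`. -/
def toSet (b : OrthonormalBasis (Fin n) ℝ V) (Q : Cell n) : Set V := Q.scaled b 1

/-- The diameter of the dyadic cell. -/
def diam (b : OrthonormalBasis (Fin n) ℝ V) (Q : Cell n) : ℝ := Metric.diam (Q.toSet b)

end Cell

/-- The distance of two sets. -/
def setDist {X : Type*} [PseudoMetricSpace X] (s t : Set X) : ℝ :=
  sInf {r | ∃ x ∈ s, ∃ y ∈ t, r = dist x y}

namespace Config

variable {n N : ℕ} (c : Config n N)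

/-- The condition `diam Q ≤ (1/20) inf_Q D` on a dyadic cell. -/
def SmallCell (b : OrthonormalBasis (Fin n) ℝ c.P₀) (Q : Cell n) : Prop :=
  Q.diam b ≤ 1 / 20 * sInf (c.D '' Q.toSet b)

/-- The Whitney family `{R_i}`, `i ∈ I`: the cells which, for some `z ∈ P₀` with `D(z) > 0`, are
the largest dyadic cell `Q` with `z ∈ Q` and `diam Q ≤ (1/20) inf_Q D`. -/
def I (b : OrthonormalBasis (Fin n) ℝ c.P₀) : Set (Cell n) :=
  {Q | ∃ z ∈ Q.toSet b, 0 < c.D z ∧ c.SmallCell b Q ∧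
    ∀ Q' : Cell n, z ∈ Q'.toSet b → c.SmallCell b Q' → Q'.diam b ≤ Q.diam b}

/-- `U_12 = B(0,12) ∩ P₀`. -/
def U12 : Set c.P₀ := closedBall 0 12

def I12 (b : OrthonormalBasis (Fin n) ℝ c.P₀) : Set (Cell n) :=
  {Q | Q ∈ c.I b ∧ (Q.toSet b ∩ c.U12).Nonempty}

/-- The choices made in the construction of the function `A`. -/
structure Choices where
  /-- the coordinate system of the dyadic grid on `P₀` -/
  basis : OrthonormalBasis (Fin n) ℝ c.P₀
  /-- the planes `P_(x,t)` -/
  plane : Euc N → ℝ → AffineSubspace ℝ (Euc N)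
  goodPlane : ∀ q ∈ c.Stotal, c.GoodPlane q.1 q.2 (plane q.1 q.2)
  /-- the balls `B_i = B(X_i,t_i)` -/
  X : Cell n → Euc N
  t : Cell n → ℝ
  mem_S : ∀ i ∈ c.I12 basis, (X i, t i) ∈ c.S
  diam_le : ∀ i ∈ c.I12 basis, i.diam basis ≤ Metric.diam (closedBall (X i) (t i))
  le_diam : ∀ i ∈ c.I12 basis, Metric.diam (closedBall (X i) (t i)) ≤ 200 * i.diam basis
  dist_le : ∀ i ∈ c.I12 basis,
    setDist (c.proj '' closedBall (X i) (t i)) (i.toSet basis) ≤ 100 * i.diam basis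
  /-- the smooth partition of unity `φ_i` of `U_12 \ π(𝒵)`; no bounds on the derivatives are
  imposed. (On `π(𝒵)`, which the cubes `3 R_i` do not meet, nothing is required.) -/
  φ : Cell n → c.P₀ → ℝ
  contDiffOn : ∀ i ∈ c.I12 basis, ContDiffOn ℝ ∞ (φ i) (c.U12 \ c.proj '' c.Z)
  nonneg : ∀ i ∈ c.I12 basis, ∀ a ∈ c.U12 \ c.proj '' c.Z, 0 ≤ φ i a
  le_one : ∀ i ∈ c.I12 basis, ∀ a ∈ c.U12 \ c.proj '' c.Z, φ i a ≤ 1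
  eq_zero : ∀ i ∈ c.I12 basis, ∀ a ∈ c.U12 \ c.proj '' c.Z, a ∉ i.scaled basis 3 → φ i a = 0
  sum_eq_one : ∀ a ∈ c.U12 \ c.proj '' c.Z, ∑ᶠ i ∈ c.I12 basis, φ i a = 1

/-- The function `P₀ → P₀ᗮ` whose graph is the plane `P`: it sends `a` to the vector `v` of `P₀ᗮ`
with `a + v ∈ P` (which is unique if the angle between `P` and `P₀` is less than `1`). -/
def graphFun (P : AffineSubspace ℝ (Euc N)) (a : c.P₀) : c.P₀ᗮ :=
  Classical.epsilon fun v : c.P₀ᗮ => (a : Euc N) + (v : Euc N) ∈ P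

namespace Choices

variable {c} (ch : c.Choices)

/-- The affine function `A_i` with graph `P_i = P_(X_i,t_i)`. -/
def Ai (i : Cell n) : c.P₀ → c.P₀ᗮ := c.graphFun (ch.plane (ch.X i) (ch.t i))

open Classical in
/-- The function `A` on `U_12`: `π^⊥ ∘ (π|_𝒵)⁻¹` on `π(𝒵)`, and `∑ φ_i A_i` off `π(𝒵)`. -/
def A (a : c.P₀) : c.P₀ᗮ :=
  if a ∈ c.proj '' c.Z then c.projPerp (Function.invFunOn c.proj c.Z a)
  else ∑ᶠ i ∈ c.I12 ch.basis, ch.φ i a • ch.Ai i a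

/-- The set `G`, with `K = 2 (104 · 10 · 6 + 214)`. -/
def G : Set (Euc N) :=
  {x | x ∈ c.F \ c.Z ∧ ∀ i ∈ c.I12 ch.basis, c.proj x ∈ i.scaled ch.basis 3 →
      x ∉ closedBall (ch.X i) ((2 * (104 * 10 * 6 + 214)) * ch.t i)} ∪
  {x | x ∈ c.F \ c.Z ∧ c.proj x ∈ c.proj '' c.Z}

/-- The set `F̃` of the points `x ∈ F \ G` with `d(x, π(x) + A(π(x))) ≤ ε^{1/2} d(x)`. -/
def Ftilde : Set (Euc N) :=
  {x | x ∈ c.F \ ch.G ∧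
    dist x ((c.proj x : Euc N) + (ch.A (c.proj x) : Euc N)) ≤ √c.ε * c.d x}

end Choices

end Config

end MengerGraph

end

/-!
The set `F \ F̃` splits into `G` and the points outside `G` which are far from the graph of `A`;
each part is estimated by a Chebyshev inequality, the first for the curvature integral, the second
for the `β`-numbers.

A pair `(X, T)` with `h X ≤ T < 50 / 3` is in `S_total` (`mem_Stotal_of_h_le`), so the ball
`B(X, T)` has mass at least `δ T^n / 2`, most of which is close to a plane at angle at most `1 / 4`
to `P₀`. A secant of such a plane is comparable to its projection (`dist_le_of_angle_le`). Hence
points of `F` that are good from the scales `t` and `s` on are no further apart than their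
projections, up to a multiple of `t + s` (`Regime.dist_le`); in particular `π` is injective on `𝒵`.

*The set `G`.* For `x ∈ G` there is a point `X ∈ F`, good from scales on that are small compared
with `T = |x - X|`, with `|π(x) - π(X)|` also small compared with `T` (`exists_good_of_mem_G`).
Since the neighbourhoods of planes of dimension less than `n` carry little mass, `B(X, T)` contains
`n + 1` small balls of definite mass all of whose transversals are fat simplices
(`exists_isSelectionConst`). Most of that mass is near the good plane of `(X, T)`, whereas `x` is
not, so `x` has distance at least `T / 10` from the simplices spanned by these points
(`Regime.exists_fat_sets`). The lower bound for proper integrands then bounds the integral of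
`𝓚^p` in the other `n + 1` variables from below by a constant (`Regime.le_lintegral`), and
`𝓜_{𝓚^p}(μ) ≤ η ≤ 2 ε` gives `μ(G) ≤ C ε` (`measure_le_of_le_lintegral`).

*Points outside `G`.* On `𝒵` the graph of `A` passes through the point. At any other point, `A` is
an average of the affine functions `A_j` over cells `R_j` with `π(x) ∈ 3 R_j`, so if the distance to
the graph exceeds `√ε d(x)`, the same is true for one of the planes `P_j`. Since `x ∉ G` and the
balls `B_i` of neighbouring cells are comparable and close to each other, `x` lies in a fixed
multiple of `B_j`, and `d(x)` is at least comparable to `t_j` (`exists_far_plane`). The bad points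
are thus covered by sets to which Chebyshev's inequality for the `β`-number of `P_j` applies, each
of measure at most `C √ε t_j^n`, and `∑ t_j^n` is bounded because the cells `R_j` are disjoint and
contained in a bounded region (`tsum_t_pow_le`).
-/

namespace MengerGraph

variable {N : ℕ}

/-! ### Planes at a small angle -/

lemma norm_sub_starProjection_le (W : Submodule ℝ (Euc N)) (v : Euc N) {w : Euc N} (hw : w ∈ W) :
    ‖v - W.starProjection v‖ ≤ ‖v - w‖ := by
  rw [Submodule.starProjection_minimal]
  exact ciInf_le ⟨0, by rintro _ ⟨x, rfl⟩; exact norm_nonneg _⟩ (⟨w, hw⟩ : W)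

lemma infDist_affineSubspace_eq (P : AffineSubspace ℝ (Euc N)) {p : Euc N} (hp : p ∈ P)
    (y : Euc N) :
    infDist y (P : Set (Euc N)) = ‖(y - p) - P.direction.starProjection (y - p)‖ := by
  apply le_antisymm
  · have hmem : P.direction.starProjection (y - p) + p ∈ P :=
      AffineSubspace.vadd_mem_of_mem_direction (Submodule.starProjection_apply_mem _ _) hp
    refine (infDist_le_dist_of_mem hmem).trans_eq ?_
    rw [dist_eq_norm]
    congr 1
    abel
  · rw [le_infDist ⟨p, hp⟩]
    intro q hq
    have hqp : q - p ∈ P.direction := AffineSubspace.vsub_mem_direction hq hp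
    refine (norm_sub_starProjection_le _ _ hqp).trans_eq ?_
    rw [dist_eq_norm]
    congr 1
    abel

/-- A vector in a subspace at small angle to `V` is controlled by its projection to `V`. -/
lemma norm_le_of_angle_le {V W : Submodule ℝ (Euc N)} (h : angle W V ≤ 1 / 4) {v : Euc N}
    (hv : v ∈ W) : ‖v‖ ≤ 4 / 3 * ‖V.starProjection v‖ := by
  have h1 : ‖(W.starProjection - V.starProjection) v‖ ≤ 1 / 4 * ‖v‖ :=
    (ContinuousLinearMap.le_opNorm _ _).trans (by gcongr; exact h)
  have h2 : (W.starProjection - V.starProjection) v = v - V.starProjection v := by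
    simp [Submodule.starProjection_eq_self_iff.2 hv]
  rw [h2] at h1
  have h3 : ‖v‖ ≤ ‖v - V.starProjection v‖ + ‖V.starProjection v‖ := norm_le_norm_sub_add _ _
  linarith

/-- Two points near a plane at small angle to `V` span a secant whose length is controlled by its
projection to `V`, up to the distances of the points to the plane. -/
lemma dist_le_of_angle_le {V : Submodule ℝ (Euc N)} {P : AffineSubspace ℝ (Euc N)}
    (hP : (P : Set (Euc N)).Nonempty) (h : angle P.direction V ≤ 1 / 4) (u w : Euc N) :
    dist u w ≤ 4 / 3 * ‖V.starProjection (u - w)‖ +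
      7 / 3 * (infDist u (P : Set (Euc N)) + infDist w (P : Set (Euc N))) := by
  obtain ⟨p, hp⟩ := hP
  rw [infDist_affineSubspace_eq P hp, infDist_affineSubspace_eq P hp]
  set W := P.direction
  set e := (u - p) - W.starProjection (u - p)
  set f := (w - p) - W.starProjection (w - p)
  set v := W.starProjection (u - w)
  have huw : u - w = v + (e - f) := by
    simp only [v, e, f, map_sub]
    abel
  have h1 := norm_le_of_angle_le h (Submodule.starProjection_apply_mem W (u - w))
  have h2 : ‖V.starProjection v‖ ≤ ‖V.starProjection (u - w)‖ + ‖e - f‖ := by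
    have : V.starProjection v = V.starProjection (u - w) - V.starProjection (e - f) := by
      rw [huw, map_add]; abel
    rw [this]
    exact (norm_sub_le _ _).trans (by gcongr; exact Submodule.norm_starProjection_apply_le _ _)
  have h3 : ‖e - f‖ ≤ ‖e‖ + ‖f‖ := norm_sub_le _ _
  have h4 : dist u w ≤ ‖v‖ + ‖e - f‖ := by
    rw [dist_eq_norm, huw]
    exact norm_add_le _ _
  change ‖v‖ ≤ 4 / 3 * ‖V.starProjection v‖ at h1
  linarith

lemma infDist_sum_smul_le {ι : Type*} [Fintype ι] {P : AffineSubspace ℝ (Euc N)}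
    (hP : (P : Set (Euc N)).Nonempty) (y : ι → Euc N) (a : ι → ℝ) (ha : ∑ i, a i = 1) :
    infDist (∑ i, a i • y i) (P : Set (Euc N)) ≤
      ∑ i, |a i| * infDist (y i) (P : Set (Euc N)) := by
  obtain ⟨p, hp⟩ := hP
  simp only [infDist_affineSubspace_eq P hp]
  have h : ∑ i, a i • y i - p = ∑ i, a i • (y i - p) := by
    simp [smul_sub, Finset.sum_sub_distrib, ← Finset.sum_smul, ha]
  rw [h, map_sum, ← Finset.sum_sub_distrib]
  refine (norm_sum_le _ _).trans (Finset.sum_le_sum fun i _ => ?_)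
  rw [map_smul, ← smul_sub, norm_smul, Real.norm_eq_abs]

/-- An `n`-plane at small angle to the `n`-dimensional subspace `V` is a graph over `V`. -/
lemma exists_mem_of_angle_le {n : ℕ} {V : Submodule ℝ (Euc N)} (hV : Module.finrank ℝ V = n)
    {P : AffineSubspace ℝ (Euc N)} (hP : IsPlane n P) (h : angle P.direction V ≤ 1 / 4) (a : V) :
    ∃ v : Vᗮ, (a : Euc N) + (v : Euc N) ∈ P := by
  obtain ⟨⟨p, hp⟩, hd⟩ := hP
  let L : P.direction →ₗ[ℝ] V :=
    (V.orthogonalProjectionOnto : Euc N →ₗ[ℝ] V) ∘ₗ P.direction.subtype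
  have hinj : Function.Injective L := by
    rw [injective_iff_map_eq_zero]
    intro v hv
    have h1 := norm_le_of_angle_le h v.2
    have h2 : V.starProjection (v : Euc N) = 0 := by
      rw [Submodule.starProjection_apply]
      exact congrArg Subtype.val hv
    rw [h2, norm_zero, mul_zero] at h1
    exact Subtype.ext (norm_le_zero_iff.1 h1)
  have hsurj : Function.Surjective L :=
    (LinearMap.injective_iff_surjective_of_finrank_eq_finrank (hd.trans hV.symm)).1 hinj
  obtain ⟨w, hw⟩ := hsurj (a - V.orthogonalProjectionOnto p)
  have hq : (w : Euc N) + p ∈ P := AffineSubspace.vadd_mem_of_mem_direction w.2 hp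
  have hproj : V.orthogonalProjectionOnto ((w : Euc N) + p) = a := by
    rw [map_add]
    have : V.orthogonalProjectionOnto (w : Euc N) = a - V.orthogonalProjectionOnto p := hw
    rw [this]; abel
  refine ⟨Vᗮ.orthogonalProjectionOnto ((w : Euc N) + p), ?_⟩
  have := V.starProjection_add_starProjection_orthogonal ((w : Euc N) + p)
  rw [Submodule.starProjection_apply, Submodule.starProjection_apply, hproj] at this
  rwa [this]

/-! ### Quantitative affine independence -/

/-- A quantitative form of affine independence: every linear combination of the points with
coefficients of sum zero has norm at least `c` times each of its coefficients. In contrast to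
`IsFatSimplex` it is plainly stable under perturbation of the points. -/
def IsQuantIndep {ι : Type*} [Fintype ι] (c : ℝ) (y : ι → Euc N) : Prop :=
  ∀ a : ι → ℝ, ∑ i, a i = 0 → ∀ i, c * |a i| ≤ ‖∑ j, a j • y j‖

lemma IsQuantIndep.perturb {m : ℕ} {c r : ℝ} {y z : Fin (m + 1) → Euc N} (h : IsQuantIndep c y)
    (hz : ∀ j, dist (z j) (y j) ≤ r) (hc : (m + 1) * r ≤ c / 2) (hc0 : 0 ≤ c) :
    IsQuantIndep (c / 2) z := by
  intro a ha i
  obtain ⟨i₀, -, hi₀⟩ := Finset.exists_max_image Finset.univ (fun i => |a i|) ⟨i, Finset.mem_univ i⟩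
  have h1 := h a ha i₀
  have h2 : ‖∑ j, a j • y j‖ ≤ ‖∑ j, a j • z j‖ + ‖∑ j, a j • (z j - y j)‖ := by
    have : ∑ j, a j • y j = ∑ j, a j • z j - ∑ j, a j • (z j - y j) := by
      simp [smul_sub]
    rw [this]
    exact norm_sub_le _ _
  have h3 : ‖∑ j, a j • (z j - y j)‖ ≤ (m + 1) * (|a i₀| * r) := by
    refine (norm_sum_le _ _).trans ((Finset.sum_le_card_nsmul _ _ (|a i₀| * r) ?_).trans_eq ?_)
    · intro j _
      rw [norm_smul, Real.norm_eq_abs, ← dist_eq_norm]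
      exact mul_le_mul (hi₀ j (Finset.mem_univ j)) (hz j) dist_nonneg (abs_nonneg _)
    · simp
  have h4 : |a i| ≤ |a i₀| := hi₀ i (Finset.mem_univ i)
  have h5 : (m + 1) * r * |a i₀| ≤ c / 2 * |a i₀| := by gcongr
  have h6 : c / 2 * |a i| ≤ c / 2 * |a i₀| := by gcongr
  nlinarith

lemma IsQuantIndep.isFatSimplex {m : ℕ} (hm : 1 ≤ m) {c : ℝ} {y : Fin (m + 1) → Euc N} (hc : 0 < c)
    (h : IsQuantIndep c y) : IsFatSimplex c y := by
  classical
  constructor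
  · rw [affineIndependent_iff]
    intro s w hw hw' e he
    have key := h (fun i => if i ∈ s then w i else 0) (by simpa [Finset.sum_ite_mem] using hw) e
    have h0 : ∑ j, (if j ∈ s then w j else 0) • y j = 0 := by
      simpa [ite_smul, Finset.sum_ite_mem] using hw'
    rw [h0, norm_zero, if_pos he] at key
    have : |w e| ≤ 0 := by
      by_contra hlt
      push Not at hlt
      nlinarith [mul_pos hc hlt]
    exact abs_eq_zero.1 (le_antisymm this (abs_nonneg _))
  · intro i
    have hne : ((affineSpan ℝ (y '' {i}ᶜ) : AffineSubspace ℝ (Euc N)) : Set (Euc N)).Nonempty := by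
      have : Nontrivial (Fin (m + 1)) := Fin.nontrivial_iff_two_le.2 (by omega)
      obtain ⟨j, hj⟩ := exists_ne i
      exact ⟨y j, subset_affineSpan ℝ _ ⟨j, hj, rfl⟩⟩
    rw [le_infDist hne]
    intro q hq
    obtain ⟨fs, w, hfs, hw, rfl⟩ := eq_affineCombination_of_mem_affineSpan_image hq
    rw [Finset.affineCombination_eq_linear_combination _ _ _ hw]
    have hi : i ∉ fs := fun hi => hfs hi rfl
    have key := h (fun j => (if j = i then 1 else 0) - if j ∈ fs then w j else 0)
      (by simp [Finset.sum_sub_distrib, Finset.sum_ite_mem, hw]) i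
    simp only [if_true, hi, if_false, sub_zero, abs_one, mul_one] at key
    refine key.trans_eq ?_
    rw [dist_eq_norm]
    congr 1
    simp [sub_smul, ite_smul, Finset.sum_sub_distrib, Finset.sum_ite_mem]

/-- If each vector stays away from the span of its predecessors, then the coefficients of a linear
combination are controlled by its norm. -/
lemma abs_coeff_le_of_triangular {σ R : ℝ} (hσ : 0 < σ) (hR : 0 ≤ R) {v : ℕ → Euc N} (m : ℕ)
    (hvR : ∀ i < m, ‖v i‖ ≤ R)
    (hv : ∀ i < m, ∀ w ∈ Submodule.span ℝ (v '' Iio i), σ ≤ ‖v i - w‖) (a : ℕ → ℝ) :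
    ∀ i < m, σ * |a i| ≤ (1 + R / σ) ^ m * ‖∑ j ∈ Finset.range m, a j • v j‖ := by
  induction m with
  | zero => intro i hi; omega
  | succ m ih =>
    have htop : σ * |a m| ≤ ‖∑ j ∈ Finset.range (m + 1), a j • v j‖ := by
      rcases eq_or_ne (a m) 0 with h0 | h0
      · rw [h0, abs_zero, mul_zero]; exact norm_nonneg _
      · have hw : -((a m)⁻¹ • ∑ j ∈ Finset.range m, a j • v j) ∈
            Submodule.span ℝ (v '' Iio m) :=
          Submodule.neg_mem _ (Submodule.smul_mem _ _ (Submodule.sum_mem _ fun j hj =>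
            Submodule.smul_mem _ _ (Submodule.subset_span
              ⟨j, by simpa using hj, rfl⟩)))
        have h1 := hv m (by omega) _ hw
        have h2 : ∑ j ∈ Finset.range (m + 1), a j • v j =
            a m • (v m - -((a m)⁻¹ • ∑ j ∈ Finset.range m, a j • v j)) := by
          rw [Finset.sum_range_succ, sub_neg_eq_add, smul_add, smul_inv_smul₀ h0, add_comm]
        rw [h2, norm_smul, Real.norm_eq_abs, mul_comm]
        gcongr
    set T := ‖∑ j ∈ Finset.range (m + 1), a j • v j‖
    have hone : 1 ≤ 1 + R / σ := by
      have : 0 ≤ R / σ := by positivity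
      linarith
    have hT : 0 ≤ T := norm_nonneg _
    have hrest : ‖∑ j ∈ Finset.range m, a j • v j‖ ≤ (1 + R / σ) * T := by
      have h1 : ∑ j ∈ Finset.range m, a j • v j =
          ∑ j ∈ Finset.range (m + 1), a j • v j - a m • v m := by
        rw [Finset.sum_range_succ]; abel
      rw [h1]
      refine (norm_sub_le _ _).trans ?_
      rw [norm_smul, Real.norm_eq_abs, add_mul, one_mul]
      refine add_le_add le_rfl ?_
      have h3 : |a m| ≤ T / σ := by
        rw [le_div_iff₀ hσ]; linarith
      calc |a m| * ‖v m‖ ≤ T / σ * R := by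
            gcongr
            exact hvR m (by omega)
        _ = R / σ * T := by ring
    intro i hi
    rcases Nat.lt_succ_iff_lt_or_eq.1 hi with hlt | rfl
    · refine (ih (fun i hi => hvR i (by omega)) (fun i hi => hv i (by omega)) i hlt).trans ?_
      rw [pow_succ, mul_assoc]
      gcongr
    · refine htop.trans (le_mul_of_one_le_left hT (one_le_pow₀ hone))

lemma isQuantIndep_cons_of_triangular {n : ℕ} {σ R : ℝ} (hσ : 0 < σ) (hR : 0 ≤ R)
    {v : ℕ → Euc N} (z : Euc N) (hvR : ∀ i < n, ‖v i‖ ≤ R)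
    (hv : ∀ i < n, ∀ w ∈ Submodule.span ℝ (v '' Iio i), σ ≤ ‖v i - w‖) :
    IsQuantIndep (σ / ((n + 1) * (1 + R / σ) ^ n))
      (Fin.cons z (fun i : Fin n => z + v i) : Fin (n + 1) → Euc N) := by
  intro a ha
  rw [Fin.sum_univ_succ] at ha
  set B := (1 + R / σ) ^ n
  have hB : 0 < B := by positivity
  set b : ℕ → ℝ := fun j => if h : j < n then a (Fin.succ ⟨j, h⟩) else 0
  have hsum : ∑ j, a j • (Fin.cons z (fun i : Fin n => z + v i) : Fin (n + 1) → Euc N) j =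
      ∑ j ∈ Finset.range n, b j • v j := by
    rw [Fin.sum_univ_succ, Finset.sum_range]
    simp only [Fin.cons_zero, Fin.cons_succ, smul_add, Finset.sum_add_distrib, ← Finset.sum_smul]
    rw [← add_assoc, ← add_smul, ha, zero_smul, zero_add]
    simp [b]
    rfl
  have key := abs_coeff_le_of_triangular hσ hR n hvR hv b
  rw [hsum]
  set T := ‖∑ j ∈ Finset.range n, b j • v j‖
  have hT : 0 ≤ T := norm_nonneg _
  have key' : ∀ i : Fin n, |a i.succ| ≤ B * T / σ := by
    intro i
    have := key i i.2
    simp only [b, i.2, dif_pos, Fin.eta] at this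
    rw [le_div_iff₀ hσ]
    linarith
  have hB1 : ∀ i, |a i| ≤ (n + 1) * (B * T / σ) := by
    have hX : 0 ≤ B * T / σ := by positivity
    intro i
    refine Fin.cases ?_ (fun i => ?_) i
    · have h0 : a 0 = -∑ i : Fin n, a i.succ := by linarith
      rw [h0, abs_neg]
      refine (Finset.abs_sum_le_sum_abs _ _).trans
        ((Finset.sum_le_card_nsmul _ _ _ fun i _ => key' i).trans ?_)
      simp
      linarith
    · refine (key' i).trans ?_
      have : (0 : ℝ) ≤ n := Nat.cast_nonneg n
      nlinarith
  intro i
  calc σ / ((n + 1) * B) * |a i| ≤ σ / ((n + 1) * B) * ((n + 1) * (B * T / σ)) := by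
        gcongr
        exact hB1 i
    _ = T := by field_simp

end MengerGraph

namespace MengerGraph

variable {N : ℕ}

/-! ### Covering arguments and the selection of fat simplices -/

/-- The part of a ball within distance `s` of an `m`-dimensional affine subspace is covered by at
most `(2M+1)^m` balls of radius comparable to `s`, where `M ≥ t/s`: the centres form a lattice. -/
lemma exists_cover_near_subspace {m : ℕ} {W : Submodule ℝ (Euc N)}
    (hW : Module.finrank ℝ W = m) (X z : Euc N) {s t : ℝ} (hs : 0 < s)
    {M : ℕ} (hM : t / s ≤ M) :
    ∃ c : (Fin m → Finset.Icc (-(M : ℤ)) M) → Euc N,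
      ∀ y ∈ closedBall X t, ‖(y - z) - W.starProjection (y - z)‖ ≤ s →
        ∃ k, dist y (c k) ≤ (m + 1) * s := by
  subst hW
  set b := stdOrthonormalBasis ℝ W
  refine ⟨fun k => X + ((z - X) - W.starProjection (z - X)) +
    ∑ j, ((k j : ℤ) * s : ℝ) • (b j : Euc N), fun y hy hyz => ?_⟩
  set u : W := W.orthogonalProjectionOnto (y - X)
  have hu : ‖u‖ ≤ t := by
    refine (Submodule.norm_orthogonalProjectionOnto_apply_le W (y - X)).trans ?_
    rwa [← dist_eq_norm]
  have hcoord : ∀ j, |b.repr u j| ≤ t := by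
    intro j
    refine le_trans ?_ hu
    rw [← b.repr.norm_map u, ← Real.norm_eq_abs]
    exact PiLp.norm_apply_le _ _
  have hk : ∀ j, ⌊b.repr u j / s⌋ ∈ Finset.Icc (-(M : ℤ)) M := by
    intro j
    have h1 := abs_le.1 (hcoord j)
    rw [Finset.mem_Icc]
    constructor
    · rw [Int.le_floor]
      push_cast
      have : -(t / s) ≤ b.repr u j / s := by
        rw [← neg_div]; gcongr; exact h1.1
      linarith
    · have h2 : ((⌊b.repr u j / s⌋ : ℤ) : ℝ) ≤ M := (Int.floor_le _).trans
        ((div_le_div_of_nonneg_right h1.2 hs.le).trans hM)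
      exact_mod_cast h2
  refine ⟨fun j => ⟨⌊b.repr u j / s⌋, hk j⟩, ?_⟩
  have hsum : ∑ j, b.repr u j • (b j : Euc N) = W.starProjection (y - X) := by
    have := congrArg Subtype.val (b.sum_repr u)
    rw [Submodule.starProjection_apply, ← this]
    simp
  have hsplit : y - (X + ((z - X) - W.starProjection (z - X)) +
      ∑ j, ((⌊b.repr u j / s⌋ : ℤ) * s : ℝ) • (b j : Euc N)) =
      ((y - z) - W.starProjection (y - z)) +
        ∑ j, (b.repr u j - (⌊b.repr u j / s⌋ : ℤ) * s) • (b j : Euc N) := by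
    simp only [sub_smul, Finset.sum_sub_distrib, hsum, map_sub]
    abel
  rw [dist_eq_norm, hsplit]
  have h2 : ‖∑ j, (b.repr u j - (⌊b.repr u j / s⌋ : ℤ) * s) • (b j : Euc N)‖ ≤
      Module.finrank ℝ W * s := by
    refine (norm_sum_le _ _).trans ((Finset.sum_le_card_nsmul _ _ s ?_).trans_eq (by simp))
    intro j _
    have hb : ‖(b j : Euc N)‖ = 1 := b.norm_eq_one j
    rw [norm_smul, hb, mul_one, Real.norm_eq_abs, abs_le]
    have h3 := Int.floor_le (b.repr u j / s)
    have h4 := Int.lt_floor_add_one (b.repr u j / s)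
    rw [le_div_iff₀ hs] at h3
    rw [div_lt_iff₀ hs] at h4
    constructor <;> linarith
  calc _ ≤ _ := norm_add_le _ _
    _ ≤ s + Module.finrank ℝ W * s := add_le_add hyz h2
    _ = _ := by ring

/-- `μ` is upper Ahlfors regular of dimension `n`. -/
def IsUpperRegular (n : ℕ) (C : ℝ) (μ : Measure (Euc N)) : Prop :=
  ∀ (x : Euc N) (r : ℝ), 0 < r → μ (closedBall x r) ≤ ENNReal.ofReal (C * (2 * r) ^ n)

/-- Neighbourhoods of affine subspaces of dimension less than `n` have small measure. -/
lemma IsUpperRegular.measure_near_subspace_le {n : ℕ} {C : ℝ} {μ : Measure (Euc N)}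
    (hμ : IsUpperRegular n C μ) (hC : 0 ≤ C) {W : Submodule ℝ (Euc N)}
    (hW : Module.finrank ℝ W < n) (X z : Euc N) {σ t : ℝ} (hσ : 0 < σ) (hσ1 : σ ≤ 1) (ht : 0 < t) :
    μ {y ∈ closedBall X t | ‖(y - z) - W.starProjection (y - z)‖ ≤ σ * t} ≤
      ENNReal.ofReal (C * (10 * (n + 1)) ^ n * σ * t ^ n) := by
  set m := Module.finrank ℝ W with hm
  have hs : 0 < σ * t := by positivity
  have hdiv : t / (σ * t) = 1 / σ := by field_simp
  obtain ⟨c, hc⟩ := exists_cover_near_subspace hm.symm X z hs (M := ⌈1 / σ⌉₊)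
    (by rw [hdiv]; exact Nat.le_ceil _)
  have hsub : {y ∈ closedBall X t | ‖(y - z) - W.starProjection (y - z)‖ ≤ σ * t} ⊆
      ⋃ k, closedBall (c k) ((m + 1) * (σ * t)) := by
    rintro y ⟨hy, hyz⟩
    obtain ⟨k, hk⟩ := hc y hy hyz
    exact mem_iUnion.2 ⟨k, hk⟩
  refine (measure_mono hsub).trans ((measure_iUnion_fintype_le μ _).trans ?_)
  refine (Finset.sum_le_sum fun k _ => hμ (c k) _ (by positivity)).trans ?_
  rw [Finset.sum_const, nsmul_eq_mul, ← ENNReal.ofReal_natCast,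
    ← ENNReal.ofReal_mul (by positivity)]
  apply ENNReal.ofReal_le_ofReal
  have hcard : ((Finset.univ : Finset (Fin m → Finset.Icc (-(⌈1 / σ⌉₊ : ℤ)) ⌈1 / σ⌉₊)).card : ℝ) ≤
      (5 / σ) ^ m := by
    have h1 : (Finset.univ : Finset (Fin m → Finset.Icc (-(⌈1 / σ⌉₊ : ℤ)) ⌈1 / σ⌉₊)).card =
        (2 * ⌈1 / σ⌉₊ + 1) ^ m := by
      rw [Finset.card_univ, Fintype.card_fun, Fintype.card_fin, Fintype.card_coe, Int.card_Icc]
      congr 1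
      omega
    rw [h1]
    push_cast
    gcongr
    have h2 : (⌈1 / σ⌉₊ : ℝ) < 1 / σ + 1 := Nat.ceil_lt_add_one (by positivity)
    have h3 : 1 ≤ 1 / σ := by rw [le_div_iff₀ hσ]; linarith
    have h4 : 5 / σ = 5 * (1 / σ) := by ring
    rw [h4]; linarith
  have hm1 : (m : ℝ) + 1 ≤ n + 1 := by
    have : m ≤ n := hW.le
    gcongr
  calc _ ≤ (5 / σ) ^ m * (C * (2 * ((n + 1) * (σ * t))) ^ n) := by gcongr
    _ = C * (5 ^ m * (2 * (n + 1)) ^ n) * (σ ^ n / σ ^ m) * t ^ n := by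
        rw [div_pow, mul_pow, mul_pow (_ + 1 : ℝ), mul_pow σ, mul_pow 2]; ring
    _ ≤ C * (5 ^ n * (2 * (n + 1)) ^ n) * σ * t ^ n := by
        have h5 : σ ^ n / σ ^ m ≤ σ := by
          rw [div_le_iff₀ (by positivity), ← pow_succ']
          exact pow_le_pow_of_le_one hσ.le hσ1 hW
        gcongr
        norm_num
    _ = _ := by
        rw [← mul_pow]; ring_nf

/-- A set of definite mass inside a ball meets some small ball in a set of definite mass. -/
lemma exists_closedBall_of_measure_ge {μ : Measure (Euc N)} {E : Set (Euc N)} {X : Euc N}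
    {t r a : ℝ} (hr : 0 < r) (ht : 0 < t) (hE : E ⊆ closedBall X t) (ha : 0 < a)
    (hm : ENNReal.ofReal a ≤ μ E) :
    ∃ y ∈ E, ENNReal.ofReal (a / (2 * ⌈2 * (N + 1) / r⌉₊ + 1) ^ N) ≤ μ (closedBall y (r * t)) := by
  set M := ⌈2 * (N + 1) / r⌉₊ with hMdef
  have hs : 0 < r * t / (2 * (N + 1)) := by positivity
  obtain ⟨c, hc⟩ := exists_cover_near_subspace (W := (⊤ : Submodule ℝ (Euc N))) (m := N)
    (by simp) X 0 hs (M := M) (t := t)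
    (by
      have : t / (r * t / (2 * (N + 1))) = 2 * (N + 1) / r := by field_simp
      rw [this]; exact Nat.le_ceil _)
  have hsub : E ⊆ ⋃ k, E ∩ closedBall (c k) (r * t / 2) := by
    intro y hy
    obtain ⟨k, hk⟩ := hc y (hE hy) (by
      rw [Submodule.starProjection_eq_self_iff.2 Submodule.mem_top, sub_self, norm_zero]
      exact hs.le)
    refine mem_iUnion.2 ⟨k, hy, hk.trans_eq ?_⟩
    field_simp
  by_contra hcon
  push Not at hcon
  set q := a / (2 * (M : ℝ) + 1) ^ N with hq
  have hq0 : 0 < q := by positivity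
  have hsmall : ∀ k, μ (E ∩ closedBall (c k) (r * t / 2)) < ENNReal.ofReal q := by
    intro k
    rcases (E ∩ closedBall (c k) (r * t / 2)).eq_empty_or_nonempty with h0 | ⟨y, hyE, hyk⟩
    · rw [h0, measure_empty]; exact ENNReal.ofReal_pos.2 hq0
    · refine (measure_mono ?_).trans_lt (hcon y hyE)
      rintro w ⟨-, hw⟩
      rw [mem_closedBall] at hw hyk ⊢
      have := dist_triangle_right w y (c k)
      linarith
  have hcard : (Finset.univ : Finset (Fin N → Finset.Icc (-(M : ℤ)) M)).card = (2 * M + 1) ^ N := by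
    rw [Finset.card_univ, Fintype.card_fun, Fintype.card_fin, Fintype.card_coe, Int.card_Icc]
    congr 1
    omega
  have hlt : ∑ k, μ (E ∩ closedBall (c k) (r * t / 2)) < ENNReal.ofReal a := by
    have hne : (Finset.univ : Finset (Fin N → Finset.Icc (-(M : ℤ)) M)).Nonempty := by
      rw [← Finset.card_pos, hcard]; positivity
    calc _ < ∑ _k : (Fin N → Finset.Icc (-(M : ℤ)) M), ENNReal.ofReal q :=
          ENNReal.sum_lt_sum_of_nonempty hne fun k _ => hsmall k
      _ = ENNReal.ofReal a := by
          rw [Finset.sum_const, hcard, nsmul_eq_mul, ← ENNReal.ofReal_natCast,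
            ← ENNReal.ofReal_mul (by positivity)]
          congr 1
          rw [hq]; push_cast; field_simp
  exact absurd (hm.trans ((measure_mono hsub).trans (measure_iUnion_fintype_le μ _))) (not_le.2 hlt)

/-- The constants `c`, `r`, `m` serve for the selection of fat simplices: a ball of radius `t` with
mass at least `lam * t ^ n` contains the centres of `n + 1` balls of radius `r * t` and of mass at
least `m * t ^ n` such that all simplices with one vertex in each of these balls are fat. -/
structure IsSelectionConst (N n : ℕ) (C lam c r m : ℝ) : Prop where
  c_pos : 0 < c
  r_pos : 0 < r
  r_le_one : r ≤ 1
  m_pos : 0 < m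
  exists_balls : ∀ μ : Measure (Euc N), IsUpperRegular n C μ → ∀ (X : Euc N) (t : ℝ), 0 < t →
    ENNReal.ofReal (lam * t ^ n) ≤ μ (closedBall X t) →
      ∃ y : Fin (n + 1) → Euc N, (∀ j, y j ∈ closedBall X t) ∧
        (∀ j, ENNReal.ofReal (m * t ^ n) ≤ μ (closedBall (y j) (r * t))) ∧
        ∀ y' : Fin (n + 1) → Euc N, (∀ j, dist (y' j) (y j) ≤ r * t) → IsQuantIndep (c * t) y'

/-- The vertices are selected one after the other, away from the plane spanned by the preceding
ones: the neighbourhood of such a plane is too small to carry the mass of the ball. -/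
lemma exists_isSelectionConst (N n : ℕ) {C lam : ℝ} (hC : 0 < C) (hlam : 0 < lam) :
    ∃ c r m : ℝ, IsSelectionConst N n C lam c r m := by
  set C' := C * (10 * (n + 1)) ^ n with hC'
  have hC'0 : 0 < C' := by positivity
  set σ := min 1 (lam / (2 * C')) with hσdef
  have hσ : 0 < σ := lt_min one_pos (by positivity)
  have hσ1 : σ ≤ 1 := min_le_left _ _
  have hσ2 : C' * σ ≤ lam / 2 := by
    have : σ ≤ lam / (2 * C') := min_le_right _ _
    calc C' * σ ≤ C' * (lam / (2 * C')) := by gcongr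
      _ = lam / 2 := by field_simp
  set c := σ / ((n + 1) * (1 + 2 / σ) ^ n) with hcdef
  have hc : 0 < c := by positivity
  set r := min 1 (c / (2 * (n + 1))) with hrdef
  have hr : 0 < r := lt_min one_pos (by positivity)
  have hr2 : (n + 1) * r ≤ c / 2 := by
    have : r ≤ c / (2 * (n + 1)) := min_le_right _ _
    calc (n + 1) * r ≤ (n + 1) * (c / (2 * (n + 1))) := by gcongr
      _ = c / 2 := by field_simp
  set Q : ℝ := (2 * ⌈2 * (N + 1) / r⌉₊ + 1) ^ N with hQ
  have hQ0 : 0 < Q := by positivity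
  refine ⟨c / 2, r, lam / 2 / Q, by positivity, hr, min_le_left _ _, by positivity, ?_⟩
  intro μ hμ X t ht hmass
  have htn : 0 < t ^ n := by positivity
  obtain ⟨z, hzB, hz⟩ := exists_closedBall_of_measure_ge hr ht (Subset.refl (closedBall X t))
    (by positivity) hmass
  have hz' : ENNReal.ofReal (lam / 2 / Q * t ^ n) ≤ μ (closedBall z (r * t)) := by
    refine le_trans (ENNReal.ofReal_le_ofReal ?_) hz
    rw [div_mul_eq_mul_div]
    gcongr
    linarith
  have hstep : ∀ W : Submodule ℝ (Euc N), Module.finrank ℝ W < n → ∃ y ∈ closedBall X t,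
      σ * t < ‖(y - z) - W.starProjection (y - z)‖ ∧
      ENNReal.ofReal (lam / 2 / Q * t ^ n) ≤ μ (closedBall y (r * t)) := by
    intro W hW
    set B := {y ∈ closedBall X t | ‖(y - z) - W.starProjection (y - z)‖ ≤ σ * t}
    have h1 : μ B ≤ ENNReal.ofReal (lam / 2 * t ^ n) := by
      refine (hμ.measure_near_subspace_le hC.le hW X z hσ hσ1 ht).trans
        (ENNReal.ofReal_le_ofReal ?_)
      gcongr
    have h2 : ENNReal.ofReal (lam / 2 * t ^ n) ≤ μ (closedBall X t \ B) := by
      have h3 : ENNReal.ofReal (lam * t ^ n) ≤ ENNReal.ofReal (lam / 2 * t ^ n) +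
          μ (closedBall X t \ B) := by
        refine hmass.trans ((measure_le_inter_add_sdiff μ _ B).trans ?_)
        gcongr
        exact (measure_mono inter_subset_right).trans h1
      have h4 : lam * t ^ n = lam / 2 * t ^ n + lam / 2 * t ^ n := by ring
      rw [h4, ENNReal.ofReal_add (by positivity) (by positivity)] at h3
      exact (ENNReal.add_le_add_iff_left ENNReal.ofReal_ne_top).1 h3
    obtain ⟨y, ⟨hy1, hy2⟩, hy3⟩ := exists_closedBall_of_measure_ge hr ht
      (sdiff_subset : closedBall X t \ B ⊆ closedBall X t) (by positivity) h2
    refine ⟨y, hy1, ?_, ?_⟩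
    · by_contra hlt
      exact hy2 ⟨hy1, not_lt.1 hlt⟩
    · rwa [div_mul_eq_mul_div]
  have hseq : ∀ m ≤ n, ∃ v : ℕ → Euc N, ∀ i < m, z + v i ∈ closedBall X t ∧
      (∀ w ∈ Submodule.span ℝ (v '' Iio i), σ * t ≤ ‖v i - w‖) ∧
      ENNReal.ofReal (lam / 2 / Q * t ^ n) ≤ μ (closedBall (z + v i) (r * t)) := by
    intro m
    induction m with
    | zero => exact fun _ => ⟨0, fun i hi => by omega⟩
    | succ m ih =>
      intro hm
      obtain ⟨v, hv⟩ := ih (by omega)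
      have hfin : Module.finrank ℝ (Submodule.span ℝ (v '' Iio m)) < n := by
        have h1 : v '' Iio m = (((Finset.range m).image v : Finset (Euc N)) : Set (Euc N)) := by
          simp [Finset.coe_image, Finset.coe_range]
        rw [h1]
        refine (finrank_span_finset_le_card _).trans_lt ?_
        refine Finset.card_image_le.trans_lt ?_
        simpa using hm
      obtain ⟨y, hyX, hyσ, hyμ⟩ := hstep _ hfin
      refine ⟨Function.update v m (y - z), fun i hi => ?_⟩
      have himg : ∀ i ≤ m, Function.update v m (y - z) '' Iio i = v '' Iio i := by
        intro i hi
        refine image_congr fun j hj => ?_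
        have : j < i := hj
        exact Function.update_of_ne (by omega) _ _
      rcases Nat.lt_succ_iff_lt_or_eq.1 hi with hlt | rfl
      · rw [himg i hlt.le, Function.update_of_ne hlt.ne]
        exact hv i hlt
      · rw [himg i le_rfl, Function.update_self]
        refine ⟨by simpa using hyX, fun w hw => ?_, by simpa using hyμ⟩
        exact hyσ.le.trans (norm_sub_starProjection_le _ _ hw)
  obtain ⟨v, hv⟩ := hseq n le_rfl
  have hquant := isQuantIndep_cons_of_triangular (n := n) (σ := σ * t) (R := 2 * t) (v := v)
    (by positivity) (by positivity) z
    (fun i hi => by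
      have h1 := (hv i hi).1
      have h2 : ‖v i‖ = dist (z + v i) z := by rw [dist_eq_norm]; simp
      rw [mem_closedBall] at h1 hzB
      rw [h2]
      have := dist_triangle_right (z + v i) z X
      linarith)
    (fun i hi => (hv i hi).2.1)
  have hcoef : σ * t / ((n + 1) * (1 + 2 * t / (σ * t)) ^ n) = c * t := by
    rw [mul_div_mul_right _ _ ht.ne', hcdef]
    ring
  rw [hcoef] at hquant
  refine ⟨Fin.cons z (fun i : Fin n => z + v i), ?_, ?_, ?_⟩
  · intro j
    refine Fin.cases ?_ (fun i => ?_) j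
    · exact hzB
    · exact (hv i i.2).1
  · intro j
    refine Fin.cases ?_ (fun i => ?_) j
    · exact hz'
    · exact (hv i i.2).2.2
  · intro y' hy'
    have := hquant.perturb hy' (by nlinarith) (by positivity)
    rwa [div_mul_eq_mul_div]

end MengerGraph

namespace MengerGraph

namespace Config

variable {n N : ℕ} {c : Config n N} {C₀ : ℝ}

/-- The properties of the data on which the estimates rest. The bound on `k` makes `B(X_j, k t_j)`
contain the points outside `G` above `3 R_j`. The bound on `ε` makes a ball of radius at least
`T / 60` with good density too heavy to stay at distance `T / 100` from a good plane of a ball of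
radius `T`. -/
structure Regime (c : Config n N) (C₀ : ℝ) : Prop where
  one_le : 1 ≤ n
  finrank_P₀ : Module.finrank ℝ c.P₀ = n
  finite : IsFiniteMeasure c.μ
  F_subset : c.F ⊆ closedBall 0 5
  upper_regular : IsUpperRegular n C₀ c.μ
  δ_pos : 0 < c.δ
  α_le : c.α ≤ 1 / 4
  le_k : 10 ^ 8 ≤ c.k
  ε_pos : 0 < c.ε
  ε_lt : 2 * c.ε / (1 / 100) < c.δ / 2 * (1 / 60) ^ n

lemma norm_starProjection_sub (u w : Euc N) :
    ‖c.P₀.starProjection (u - w)‖ = dist (c.proj u) (c.proj w) := by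
  rw [Submodule.starProjection_apply, map_sub, dist_eq_norm]
  rfl

lemma dist_proj_le (u w : Euc N) : dist (c.proj u) (c.proj w) ≤ dist u w := by
  rw [← norm_starProjection_sub, dist_eq_norm]
  exact Submodule.norm_starProjection_apply_le _ _

lemma Regime.proj_mem_U12 (hc : c.Regime C₀) {x : Euc N} (hx : x ∈ c.F) : c.proj x ∈ c.U12 := by
  have h1 := hc.F_subset hx
  have h2 := c.dist_proj_le x 0
  have h3 : c.proj 0 = 0 := map_zero c.P₀.orthogonalProjectionOnto
  rw [h3] at h2
  rw [mem_closedBall] at h1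
  rw [U12, mem_closedBall]
  linarith

/-! ### Good scales -/

lemma le_h {x : Euc N} {t : ℝ} (ht : t ∈ c.H x) : t ≤ c.h x := by
  refine le_csSup ⟨50, ?_⟩ (Or.inl ht)
  rintro s (hs | hs)
  · exact hs.1.2.le
  · rw [mem_singleton_iff.1 hs]; norm_num

lemma mem_Stotal_of_h_le {X : Euc N} (hX : X ∈ c.F) {T : ℝ} (h0 : 0 < T) (hT : T < 50 / 3)
    (h : c.h X ≤ T) : (X, T) ∈ c.Stotal := by
  by_contra hn
  -- If `(X, T)` were a bad pair, then `3 * T` would be one of the competitors for `h X`.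
  have : 3 * T ∈ c.H X :=
    ⟨⟨by linarith, by linarith⟩, X, hX, T, by linarith, by linarith, by simpa using h0, hn⟩
  have := le_h this
  linarith

/-- `h` is lower semicontinuous at its zeros: a limit of points where `h` tends to zero is again a
zero of `h`. -/
lemma h_eq_zero_of_approx {x : Euc N}
    (hx : ∀ ρ > 0, ∃ X, dist X x < ρ ∧ c.h X < ρ) : c.h x = 0 := by
  have hH : c.H x = ∅ := by
    rw [eq_empty_iff_forall_notMem]
    rintro t ⟨ht, y, hy, τ, h1, h2, h3, h4⟩
    obtain ⟨X, hX, hX'⟩ := hx (min t (τ / 3 - dist x y)) (lt_min ht.1 (by linarith))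
    have h5 := hX.trans_le (min_le_right _ _)
    have h6 : t ∈ c.H X := ⟨ht, y, hy, τ, h1, h2, by
      have := dist_triangle X x y
      linarith, h4⟩
    have := le_h h6
    have := hX'.trans_le (min_le_left _ _)
    linarith
  simp [h, hH]

lemma ofReal_le_measure_of_mem_Stotal [IsFiniteMeasure c.μ] {X : Euc N} {T : ℝ}
    (h : (X, T) ∈ c.Stotal) :
    ENNReal.ofReal (c.δ / 2 * T ^ n) ≤ c.μ (closedBall X T) := by
  have h1 : c.δ / 2 ≤ density n c.μ X T := h.2.2.1
  have hT : 0 < T := h.2.1.1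
  rw [density, le_div_iff₀ (by positivity)] at h1
  rw [← ofReal_measureReal (measure_ne_top _ _)]
  exact ENNReal.ofReal_le_ofReal h1

/-- Chebyshev's inequality for the `β`-number of a good plane. -/
lemma GoodPlane.measure_le {X : Euc N} {T κ : ℝ} {P : AffineSubspace ℝ (Euc N)}
    (hP : c.GoodPlane X T P) (hε : 0 ≤ c.ε) (hT : 0 < T) (hκ : 0 < κ) {E : Set (Euc N)}
    (hE : E ⊆ closedBall X (c.k * T))
    (hE' : ∀ y ∈ E, κ * T ≤ infDist y (P : Set (Euc N))) :
    c.μ E ≤ ENNReal.ofReal (2 * c.ε / κ * T ^ n) := by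
  have hTn : 0 < T ^ n := by positivity
  have h1 := hP.2.1
  rw [betaPlane, ENNReal.div_le_iff (ENNReal.ofReal_pos.2 hTn).ne' ENNReal.ofReal_ne_top,
    ← ENNReal.ofReal_mul (by linarith)] at h1
  have hmeas : Measurable fun y : Euc N => ENNReal.ofReal (infDist y (P : Set (Euc N)) / T) :=
    ((continuous_infDist_pt _).measurable.div_const T).ennreal_ofReal
  have h2 := mul_meas_ge_le_lintegral₀ (μ := c.μ.restrict (closedBall X (c.k * T)))
    hmeas.aemeasurable (ENNReal.ofReal κ)
  have h3 : c.μ E ≤ c.μ.restrict (closedBall X (c.k * T))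
      {y | ENNReal.ofReal κ ≤ ENNReal.ofReal (infDist y (P : Set (Euc N)) / T)} := by
    rw [Measure.restrict_apply (measurableSet_le measurable_const hmeas)]
    refine measure_mono fun y hy => ⟨ENNReal.ofReal_le_ofReal ?_, hE hy⟩
    rw [le_div_iff₀ hT]
    exact hE' y hy
  have h4 : ENNReal.ofReal κ * c.μ E ≤ ENNReal.ofReal κ * ENNReal.ofReal (2 * c.ε / κ * T ^ n) := by
    rw [← ENNReal.ofReal_mul hκ.le]
    have : κ * (2 * c.ε / κ * T ^ n) = 2 * c.ε * T ^ n := by field_simp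
    rw [this]
    exact le_trans (by gcongr) (h2.trans h1)
  exact (ENNReal.mul_le_mul_iff_right (ENNReal.ofReal_pos.2 hκ).ne' ENNReal.ofReal_ne_top).1 h4

/-- Near a point `Y` of the support there are points close to a good plane of a larger ball. -/
lemma Regime.exists_near_plane (hc : c.Regime C₀) {X Y : Euc N} {T : ℝ}
    {P : AffineSubspace ℝ (Euc N)} (hP : c.GoodPlane X T P) (hT : 0 < T) (hT' : T ≤ 10)
    (hY : Y ∈ c.F) (hYX : dist Y X ≤ T) {A : ℝ} (hA1 : 1 ≤ A) (hA : A ≤ 60) (hh : c.h Y ≤ T / A) :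
    ∃ y, dist y Y ≤ T / A ∧ infDist y (P : Set (Euc N)) ≤ T / 100 := by
  have hA0 : 0 < A := by linarith
  have hle : T / A ≤ T := div_le_self hT.le hA1
  have hfin := hc.finite
  by_contra hcon
  push Not at hcon
  have hS := mem_Stotal_of_h_le hY (div_pos hT hA0) (by linarith) hh
  have h1 := ofReal_le_measure_of_mem_Stotal hS
  have h2 := hP.measure_le hc.ε_pos.le hT (κ := 1 / 100) (by norm_num)
    (E := closedBall Y (T / A)) (by
      intro y hy
      rw [mem_closedBall] at hy ⊢
      have := dist_triangle y Y X
      have hk := hc.le_k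
      nlinarith) (fun y hy => by
      have := hcon y hy
      linarith)
  have h3 := h1.trans h2
  have hδ := hc.δ_pos
  have hTn : 0 < T ^ n := by positivity
  rw [ENNReal.ofReal_le_ofReal_iff (by have := hc.ε_pos; positivity)] at h3
  have h4 : c.δ / 2 * (1 / 60) ^ n * T ^ n ≤ c.δ / 2 * (T / A) ^ n := by
    rw [mul_assoc, ← mul_pow]
    gcongr
    rw [div_mul_eq_mul_div, one_mul]
    gcongr
  have h5 := mul_lt_mul_of_pos_right hc.ε_lt hTn
  linarith

lemma Regime.dist_le_ten (hc : c.Regime C₀) {X Y : Euc N} (hX : X ∈ c.F) (hY : Y ∈ c.F) :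
    dist X Y ≤ 10 := by
  have h1 := hc.F_subset hX
  have h2 := hc.F_subset hY
  rw [mem_closedBall] at h1 h2
  have := dist_triangle_right X Y 0
  linarith

lemma Regime.exists_goodPlane (hc : c.Regime C₀) {X : Euc N} (hX : X ∈ c.F) {T : ℝ}
    (hT : 0 < T) (hT' : T ≤ 10) (hh : c.h X ≤ T) :
    (X, T) ∈ c.Stotal ∧ ∃ P, c.GoodPlane X T P ∧ (P : Set (Euc N)).Nonempty ∧
      angle P.direction c.P₀ ≤ 1 / 4 := by
  have hS := mem_Stotal_of_h_le hX hT (by linarith) hh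
  obtain ⟨P, hP⟩ := hS.2.2.2.2
  exact ⟨hS, P, hP, hP.1.1, hP.2.2.trans hc.α_le⟩

/-- Two points of the support are no further apart than their projections, up to the scales from
which on they are good. -/
lemma Regime.dist_le (hc : c.Regime C₀) {X Y : Euc N} (hX : X ∈ c.F) (hY : Y ∈ c.F) {t s : ℝ}
    (ht : 0 < t) (hs : 0 < s) (hXt : c.h X ≤ t) (hYs : c.h Y ≤ s) :
    dist X Y ≤ 20 * (dist (c.proj X) (c.proj Y) + t + s) := by
  by_contra hcon
  push Not at hcon
  set T := dist X Y with hT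
  have hp : 0 ≤ dist (c.proj X) (c.proj Y) := dist_nonneg
  have hT0 : 0 < T := by linarith
  have hT10 : T ≤ 10 := hc.dist_le_ten hX hY
  obtain ⟨-, P, hP, hne, hang⟩ := hc.exists_goodPlane hX hT0 hT10 (by linarith)
  obtain ⟨x, hx, hxP⟩ := hc.exists_near_plane hP hT0 hT10 hX (by simpa using hT0.le) (A := 20)
    (by norm_num) (by norm_num) (by linarith)
  obtain ⟨y, hy, hyP⟩ := hc.exists_near_plane hP hT0 hT10 hY (by rw [dist_comm]) (A := 20)
    (by norm_num) (by norm_num) (by linarith)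
  have h1 := dist_le_of_angle_le hne hang x y
  rw [norm_starProjection_sub] at h1
  have h2 : dist (c.proj x) (c.proj y) ≤ dist x X + dist (c.proj X) (c.proj Y) + dist y Y := by
    have h3 := dist_triangle4 (c.proj x) (c.proj X) (c.proj Y) (c.proj y)
    have h4 := c.dist_proj_le x X
    have h5 := c.dist_proj_le Y y
    rw [dist_comm Y y] at h5
    linarith
  have h3 : T ≤ dist x X + dist x y + dist y Y := by
    have := dist_triangle4 X x y Y
    rw [dist_comm X x] at this
    linarith
  linarith

lemma Regime.injOn_proj (hc : c.Regime C₀) : InjOn c.proj c.Z := by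
  intro X hX Y hY hXY
  refine dist_le_zero.1 (le_of_forall_pos_le_add fun ρ hρ => ?_)
  have := hc.dist_le hX.1 hY.1 (t := ρ / 40) (s := ρ / 40) (by positivity) (by positivity)
    (by rw [hX.2]; positivity) (by rw [hY.2]; positivity)
  rw [hXY, dist_self] at this
  linarith

/-! ### Points of large curvature -/

/-- If `x` lies above a good point `X`, far away from it at the scales from which on `X` is good,
then `x` is far from the simplices spanned by large sets of points near `X`. -/
lemma Regime.exists_fat_sets (hc : c.Regime C₀) {c₁ r m : ℝ}
    (hsel : IsSelectionConst N n C₀ (c.δ / 2) c₁ r m) {κ : ℝ} (hκ : 0 < κ)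
    (hκ' : (n + 1) * ((1 + 4 / c₁) * κ) ≤ 1 / 100) (hε : 2 * c.ε / κ ≤ m / 2)
    {x X : Euc N} {T : ℝ} (hx : x ∈ c.F) (hX : X ∈ c.F) (hT : dist x X = T) (hT0 : 0 < T)
    (hh : c.h X ≤ T / 60) (hproj : dist (c.proj x) (c.proj X) ≤ T / 60) :
    ∃ E : Fin (n + 1) → Set (Euc N), (∀ j, MeasurableSet (E j)) ∧
      (∀ j, ENNReal.ofReal (m / 2 * T ^ n) ≤ c.μ (E j)) ∧
      ∀ y : Fin (n + 1) → Euc N, (∀ j, y j ∈ E j) →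
        IsQuantIndep (c₁ * T) y ∧ (∀ j, y j ∈ closedBall X (2 * T)) ∧
          T / 10 ≤ infDist x (affineSpan ℝ (range y) : Set (Euc N)) := by
  classical
  have hc₁ := hsel.c_pos
  have hT10 : T ≤ 10 := hT ▸ hc.dist_le_ten hx hX
  have hTn : 0 < T ^ n := by positivity
  have hfin := hc.finite
  obtain ⟨hS, P, hP, hne, hang⟩ := hc.exists_goodPlane hX hT0 hT10 (by linarith)
  obtain ⟨x', hx', hx'P⟩ := hc.exists_near_plane hP hT0 hT10 hX (by simpa using hT0.le) (A := 60)
    (by norm_num) le_rfl hh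
  obtain ⟨y₀, hy₀X, hy₀m, hy₀⟩ := hsel.exists_balls c.μ hc.upper_regular X T hT0
    (ofReal_le_measure_of_mem_Stotal hS)
  have hrT : r * T ≤ T := mul_le_of_le_one_left hT0.le hsel.r_le_one
  have hball : ∀ j, closedBall (y₀ j) (r * T) ⊆ closedBall X (2 * T) := fun j y hy => by
    have h1 := hy₀X j
    rw [mem_closedBall] at hy h1 ⊢
    have := dist_triangle y (y₀ j) X
    linarith
  refine ⟨fun j => closedBall (y₀ j) (r * T) ∩ {y | infDist y (P : Set (Euc N)) < κ * T},
    fun j => isClosed_closedBall.measurableSet.inter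
      (measurableSet_lt (continuous_infDist_pt _).measurable measurable_const), fun j => ?_, ?_⟩
  · have h1 := hP.measure_le hc.ε_pos.le hT0 hκ
      (E := closedBall (y₀ j) (r * T) \ {y | infDist y (P : Set (Euc N)) < κ * T})
      ((sdiff_subset.trans (hball j)).trans (closedBall_subset_closedBall (by
        have := hc.le_k
        nlinarith)))
      (fun y hy => not_lt.1 hy.2)
    have h2 : ENNReal.ofReal (m * T ^ n) ≤
        c.μ (closedBall (y₀ j) (r * T) ∩ {y | infDist y (P : Set (Euc N)) < κ * T}) +
          ENNReal.ofReal (m / 2 * T ^ n) := by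
      refine (hy₀m j).trans ((measure_le_inter_add_sdiff _ _
        {y | infDist y (P : Set (Euc N)) < κ * T}).trans ?_)
      gcongr
      exact h1.trans (ENNReal.ofReal_le_ofReal (by gcongr))
    have hm := hsel.m_pos
    have h3 : m * T ^ n = m / 2 * T ^ n + m / 2 * T ^ n := by ring
    rw [h3, ENNReal.ofReal_add (by positivity) (by positivity)] at h2
    exact (ENNReal.add_le_add_iff_right ENNReal.ofReal_ne_top).1 h2
  · intro y hy
    have hq := hy₀ y fun j => (hy j).1
    have hyX : ∀ j, y j ∈ closedBall X (2 * T) := fun j => hball j (hy j).1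
    refine ⟨hq, hyX, ?_⟩
    rw [le_infDist ⟨y 0, subset_affineSpan ℝ _ (mem_range_self 0)⟩]
    intro q hqmem
    by_contra hlt
    push Not at hlt
    obtain ⟨w, hw, hqw⟩ := eq_affineCombination_of_mem_affineSpan_of_fintype hqmem
    rw [Finset.affineCombination_eq_linear_combination _ _ _ hw] at hqw
    -- The barycentric coordinates of `q` are bounded because the simplex is fat.
    have hwj : ∀ j, |w j| ≤ 1 + 4 / c₁ := by
      intro j
      have h1 := hq (fun i => w i - if i = 0 then 1 else 0)
        (by simp [Finset.sum_sub_distrib, hw]) j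
      have h2 : ∑ i, (w i - if i = 0 then 1 else 0) • y i = q - y 0 := by
        simp [sub_smul, ite_smul, Finset.sum_sub_distrib, hqw]
      have h3 : ‖q - y 0‖ ≤ 4 * T := by
        have h4 := hyX 0
        rw [mem_closedBall, dist_comm] at h4
        rw [← dist_eq_norm]
        have := dist_triangle4 q x X (y 0)
        rw [dist_comm q x] at this
        linarith
      rw [h2] at h1
      have h5 : |w j - if j = 0 then 1 else 0| ≤ 4 / c₁ := by
        rw [le_div_iff₀ hc₁]
        have h6 := h1.trans h3
        by_contra hgt
        push Not at hgt
        nlinarith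
      have h7 : |(if j = 0 then 1 else 0 : ℝ)| ≤ 1 := by split_ifs <;> simp
      have h8 := abs_sub_abs_le_abs_sub (w j) (if j = 0 then 1 else 0)
      linarith
    have hqP : infDist q (P : Set (Euc N)) ≤ T / 100 := by
      rw [hqw]
      refine (infDist_sum_smul_le hne y w hw).trans ?_
      calc ∑ j, |w j| * infDist (y j) (P : Set (Euc N))
          ≤ ∑ _j : Fin (n + 1), (1 + 4 / c₁) * (κ * T) := by
            refine Finset.sum_le_sum fun j _ => ?_
            have := hwj j
            have h9 : infDist (y j) (P : Set (Euc N)) ≤ κ * T := (hy j).2.le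
            have := infDist_nonneg (x := y j) (s := (P : Set (Euc N)))
            gcongr
        _ = (n + 1) * ((1 + 4 / c₁) * κ) * T := by simp; ring
        _ ≤ 1 / 100 * T := by gcongr
        _ = T / 100 := by ring
    have hxP : infDist x (P : Set (Euc N)) ≤ T / 100 + T / 10 := by
      have := infDist_le_infDist_add_dist (s := (P : Set (Euc N))) (x := x) (y := q)
      linarith
    have h1 := dist_le_of_angle_le hne hang x x'
    rw [norm_starProjection_sub] at h1
    have h2 := dist_triangle (c.proj x) (c.proj X) (c.proj x')
    have h3 := c.dist_proj_le X x'
    have h4 := dist_triangle x x' X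
    rw [dist_comm X x'] at h3
    linarith

end Config

/-- The lower bound in the definition of a proper integrand, with its constants. -/
def HasLowerBound {N n : ℕ} (p : ℝ) (𝓚 : (Fin (n + 2) → Euc N) → ℝ≥0) (C l : ℝ) : Prop :=
  ∀ (t A : ℝ) (x : Euc N) (y : Fin (n + 1) → Euc N), 0 < t → 1 ≤ A →
    IsFatSimplex (t / A) y → (∀ i, y i ∈ closedBall x (A * t)) →
    ∀ w ∈ closedBall x (A * t),
      (infDist w (affineSpan ℝ (range y) : Set (Euc N)) / t) ^ p ≤
        C * A ^ l * t ^ (n * (n + 1)) * (𝓚 (Fin.snoc (α := fun _ => Euc N) y w) : ℝ) ^ p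

namespace Config

variable {n N : ℕ} {c : Config n N} {C₀ : ℝ}

/-- In the situation of `exists_fat_sets` the curvature integral with one variable fixed at `x`
is bounded below: the powers of the scale `T` cancel. -/
lemma Regime.le_lintegral (hc : c.Regime C₀) {c₁ r m : ℝ}
    (hsel : IsSelectionConst N n C₀ (c.δ / 2) c₁ r m) {κ : ℝ} (hκ : 0 < κ)
    (hκ' : (n + 1) * ((1 + 4 / c₁) * κ) ≤ 1 / 100) (hε : 2 * c.ε / κ ≤ m / 2)
    {x X : Euc N} {T : ℝ} (hx : x ∈ c.F) (hX : X ∈ c.F) (hT : dist x X = T) (hT0 : 0 < T)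
    (hh : c.h X ≤ T / 60) (hproj : dist (c.proj x) (c.proj X) ≤ T / 60)
    {p : ℝ} (hp : 0 < p) {𝓚 : (Fin (n + 2) → Euc N) → ℝ≥0} {C l : ℝ} (hC : 1 ≤ C)
    (hK : HasLowerBound p 𝓚 C l) :
    ENNReal.ofReal ((1 / 10) ^ p / (C * max 2 (1 / c₁) ^ l) * (m / 2) ^ (n + 1)) ≤
      ∫⁻ y, (𝓚 (Fin.snoc (α := fun _ => Euc N) y x) : ℝ≥0∞) ^ p
        ∂(Measure.pi fun _ : Fin (n + 1) => c.μ) := by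
  have hfin := hc.finite
  have hc₁ := hsel.c_pos
  have hm := hsel.m_pos
  obtain ⟨E, hEm, hEμ, hE⟩ := hc.exists_fat_sets hsel hκ hκ' hε hx hX hT hT0 hh hproj
  set A := max 2 (1 / c₁) with hA
  have hA2 : 2 ≤ A := le_max_left _ _
  have hA0 : 0 < A := by linarith
  have hAl : 0 < A ^ l := Real.rpow_pos_of_pos hA0 l
  have hTA : T / A ≤ c₁ * T := by
    rw [div_le_iff₀ hA0]
    have : 1 ≤ c₁ * A := by
      have h1 : 1 / c₁ ≤ A := le_max_right _ _
      rw [div_le_iff₀ hc₁] at h1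
      linarith
    nlinarith
  have hCpos : 0 < C := by linarith
  set τ := T ^ (n * (n + 1)) with hτ
  have hτ0 : 0 < τ := by positivity
  have h10 : (0 : ℝ) < (1 / 10) ^ p := Real.rpow_pos_of_pos (by norm_num) p
  have hpt : ∀ y ∈ Set.univ.pi E, ENNReal.ofReal ((1 / 10) ^ p / (C * A ^ l * τ)) ≤
      (𝓚 (Fin.snoc (α := fun _ => Euc N) y x) : ℝ≥0∞) ^ p := by
    intro y hy
    obtain ⟨h1, h2, h3⟩ := hE y fun j => hy j (mem_univ j)
    have hfat := h1.isFatSimplex hc.one_le (by positivity)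
    have hsub : closedBall X (2 * T) ⊆ closedBall X (A * T) :=
      closedBall_subset_closedBall (by gcongr)
    have h4 := hK T A X y hT0 (by linarith) ⟨hfat.1, fun i => hTA.trans (hfat.2 i)⟩
      (fun i => hsub (h2 i)) x (by
        rw [mem_closedBall, hT]
        nlinarith)
    have h5 : (1 / 10 : ℝ) ^ p ≤ (infDist x (affineSpan ℝ (range y) : Set (Euc N)) / T) ^ p := by
      refine Real.rpow_le_rpow (by norm_num) ?_ hp.le
      rw [le_div_iff₀ hT0]
      linarith
    rw [← ENNReal.coe_rpow_of_nonneg _ hp.le, ← ENNReal.ofReal_coe_nnreal]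
    apply ENNReal.ofReal_le_ofReal
    rw [div_le_iff₀ (by positivity), NNReal.coe_rpow]
    linarith
  have hval : (1 / 10) ^ p / (C * A ^ l) * (m / 2) ^ (n + 1) =
      (1 / 10) ^ p / (C * A ^ l * τ) * (m / 2 * T ^ n) ^ (n + 1) := by
    have : (T ^ n) ^ (n + 1) = τ := by rw [← pow_mul]
    rw [mul_pow, this]
    field_simp
  have hEpi : MeasurableSet (Set.univ.pi E) := MeasurableSet.univ_pi hEm
  calc _ = ENNReal.ofReal ((1 / 10) ^ p / (C * A ^ l * τ)) *
        ENNReal.ofReal (m / 2 * T ^ n) ^ (n + 1) := by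
        rw [hval, ENNReal.ofReal_mul (by positivity), ENNReal.ofReal_pow (by positivity)]
    _ ≤ ENNReal.ofReal ((1 / 10) ^ p / (C * A ^ l * τ)) *
        (Measure.pi fun _ : Fin (n + 1) => c.μ) (Set.univ.pi E) := by
        rw [Measure.pi_pi]
        gcongr
        calc ENNReal.ofReal (m / 2 * T ^ n) ^ (n + 1) =
            ∏ _j : Fin (n + 1), ENNReal.ofReal (m / 2 * T ^ n) := by simp
          _ ≤ _ := Finset.prod_le_prod' fun j _ => hEμ j
    _ = ∫⁻ _y in Set.univ.pi E, ENNReal.ofReal ((1 / 10) ^ p / (C * A ^ l * τ))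
        ∂(Measure.pi fun _ : Fin (n + 1) => c.μ) := by rw [setLIntegral_const]
    _ ≤ ∫⁻ y in Set.univ.pi E, (𝓚 (Fin.snoc (α := fun _ => Euc N) y x) : ℝ≥0∞) ^ p
        ∂(Measure.pi fun _ : Fin (n + 1) => c.μ) := setLIntegral_mono' hEpi hpt
    _ ≤ _ := setLIntegral_le_lintegral _ _

end Config

/-- Markov's inequality for the curvature integral as a function of one of the points. The set
need not be measurable. -/
lemma measure_le_of_le_lintegral {n N : ℕ} {μ : Measure (Euc N)} [IsFiniteMeasure μ] {p a η : ℝ}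
    {𝓚 : (Fin (n + 2) → Euc N) → ℝ≥0} (hK : AEMeasurable 𝓚 (Measure.pi fun _ => μ))
    (hη : mengerCurvature p 𝓚 μ ≤ ENNReal.ofReal η) (ha : 0 < a) {G : Set (Euc N)}
    (hG : ∀ x ∈ G, ENNReal.ofReal a ≤ ∫⁻ y, (𝓚 (Fin.snoc (α := fun _ => Euc N) y x) : ℝ≥0∞) ^ p
        ∂(Measure.pi fun _ : Fin (n + 1) => μ)) :
    μ G ≤ ENNReal.ofReal (η / a) := by
  have hmp := measurePreserving_piFinSuccAbove (fun _ : Fin (n + 2) => μ) (Fin.last (n + 1))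
  set e := MeasurableEquiv.piFinSuccAbove (fun _ : Fin (n + 2) => Euc N) (Fin.last (n + 1)) with he
  have hf : AEMeasurable (fun z => (𝓚 z : ℝ≥0∞) ^ p) (Measure.pi fun _ : Fin (n + 2) => μ) :=
    hK.coe_nnreal_ennreal.pow_const p
  have hsymm := hmp.symm e
  have hg : AEMeasurable (fun q => (𝓚 (e.symm q) : ℝ≥0∞) ^ p)
      (μ.prod (Measure.pi fun _ : Fin (n + 1) => μ)) :=
    hf.comp_quasiMeasurePreserving hsymm.quasiMeasurePreserving
  have hint : mengerCurvature p 𝓚 μ =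
      ∫⁻ x, ∫⁻ y, (𝓚 (Fin.snoc (α := fun _ => Euc N) y x) : ℝ≥0∞) ^ p
        ∂(Measure.pi fun _ : Fin (n + 1) => μ) ∂μ := by
    rw [mengerCurvature, ← hsymm.lintegral_comp_emb e.symm.measurableEmbedding]
    refine (lintegral_prod _ hg).trans ?_
    refine lintegral_congr fun x => lintegral_congr fun y => ?_
    have : e.symm (x, y) = Fin.snoc (α := fun _ => Euc N) y x := Fin.insertNth_last' x y
    rw [this]
  have hmeas : AEMeasurable (fun x => ∫⁻ y, (𝓚 (Fin.snoc (α := fun _ => Euc N) y x) : ℝ≥0∞) ^ p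
        ∂(Measure.pi fun _ : Fin (n + 1) => μ)) μ := by
    refine hg.lintegral_prod_right'.congr (Filter.Eventually.of_forall fun x => ?_)
    refine lintegral_congr fun y => ?_
    have : e.symm (x, y) = Fin.snoc (α := fun _ => Euc N) y x := Fin.insertNth_last' x y
    rw [this]
  have h1 := mul_meas_ge_le_lintegral₀ hmeas (ENNReal.ofReal a)
  rw [← hint] at h1
  have h2 : ENNReal.ofReal a * μ G ≤ ENNReal.ofReal η :=
    le_trans (by gcongr; exact hG) (h1.trans hη)
  rw [ENNReal.ofReal_div_of_pos ha, ENNReal.le_div_iff_mul_le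
    (Or.inl (ENNReal.ofReal_pos.2 ha).ne') (Or.inl ENNReal.ofReal_ne_top), mul_comm]
  exact h2

end MengerGraph

namespace MengerGraph

/-! ### Dyadic cells -/

namespace Cell

variable {n N : ℕ} {V : Submodule ℝ (Euc N)} (b : OrthonormalBasis (Fin n) ℝ V)

lemma two_zpow_pos (l : ℤ) : (0 : ℝ) < 2 ^ l := by positivity

lemma mem_toSet {Q : Cell n} {y : V} :
    y ∈ Q.toSet b ↔ ∀ j, b.repr y j ∈ Ico ((Q.pos j : ℝ) * 2 ^ Q.level)
      (((Q.pos j : ℝ) + 1) * 2 ^ Q.level) := by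
  rw [toSet, scaled, mem_ofPred_eq]
  refine forall_congr' fun j => ?_
  have h1 : (Q.pos j : ℝ) + 1 / 2 - 1 / 2 = Q.pos j := by ring
  have h2 : (Q.pos j : ℝ) + 1 / 2 + 1 / 2 = Q.pos j + 1 := by ring
  rw [h1, h2]

lemma toSet_subset_scaled (Q : Cell n) : Q.toSet b ⊆ Q.scaled b 3 := by
  intro y hy j
  have h := hy j
  have h0 := two_zpow_pos Q.level
  constructor
  · refine le_trans ?_ h.1
    gcongr
    linarith
  · refine h.2.trans_le ?_
    gcongr
    linarith

/-- The cell of a given level containing a given point. -/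
noncomputable def cellAt (l : ℤ) (y : V) : Cell n := ⟨l, fun j => ⌊b.repr y j / 2 ^ l⌋⟩

lemma mem_toSet_iff_floor {Q : Cell n} {y : V} :
    y ∈ Q.toSet b ↔ ∀ j, ⌊b.repr y j / 2 ^ Q.level⌋ = Q.pos j := by
  rw [mem_toSet]
  refine forall_congr' fun j => ?_
  rw [Int.floor_eq_iff, mem_Ico, le_div_iff₀ (two_zpow_pos _), div_lt_iff₀ (two_zpow_pos _)]

lemma mem_cellAt (l : ℤ) (y : V) : y ∈ (cellAt b l y).toSet b :=
  (mem_toSet_iff_floor b).2 fun _ => rfl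

lemma eq_cellAt {Q : Cell n} {y : V} (h : y ∈ Q.toSet b) : Q = cellAt b Q.level y := by
  rcases Q with ⟨l, q⟩
  rw [cellAt, Cell.mk.injEq]
  exact ⟨rfl, funext fun j => ((mem_toSet_iff_floor b).1 h j).symm⟩

/-- Dyadic cells are nested. -/
lemma toSet_subset_of_level_le {Q Q' : Cell n} (hl : Q.level ≤ Q'.level) {w : V}
    (hw : w ∈ Q.toSet b) (hw' : w ∈ Q'.toSet b) : Q.toSet b ⊆ Q'.toSet b := by
  intro z hz
  rw [mem_toSet] at *
  intro j
  obtain ⟨k, hk⟩ := Int.le.dest hl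
  have hpow : (2 : ℝ) ^ Q'.level = 2 ^ k * 2 ^ Q.level := by
    rw [← hk, zpow_add₀ two_ne_zero, zpow_natCast, mul_comm]
  have h0 := two_zpow_pos Q.level
  have hz := hz j
  have hw := hw j
  have hw' := hw' j
  rw [hpow, ← mul_assoc, ← mul_assoc] at hw' ⊢
  have h1 : Q'.pos j * 2 ^ k < Q.pos j + 1 := by
    have := lt_of_mul_lt_mul_right (hw'.1.trans_lt hw.2) h0.le
    exact_mod_cast this
  have h2 : Q.pos j < (Q'.pos j + 1) * 2 ^ k := by
    have := lt_of_mul_lt_mul_right (hw.1.trans_lt hw'.2) h0.le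
    exact_mod_cast this
  have h3 : (Q'.pos j : ℝ) * 2 ^ k ≤ Q.pos j := by exact_mod_cast Int.lt_add_one_iff.1 h1
  have h4 : (Q.pos j : ℝ) + 1 ≤ (Q'.pos j + 1) * 2 ^ k := by exact_mod_cast Int.add_one_le_iff.2 h2
  constructor
  · exact le_trans (by gcongr) hz.1
  · exact hz.2.trans_le (by gcongr)

/-- The centre of a cell. -/
noncomputable def center (Q : Cell n) : V :=
  b.repr.symm (WithLp.toLp 2 fun j => ((Q.pos j : ℝ) + 1 / 2) * 2 ^ Q.level)

lemma repr_center (Q : Cell n) (j : Fin n) :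
    b.repr (Q.center b) j = ((Q.pos j : ℝ) + 1 / 2) * 2 ^ Q.level := by
  simp [center]

lemma mem_scaled_iff {Q : Cell n} {r : ℝ} {y : V} :
    y ∈ Q.scaled b r ↔ ∀ j, b.repr (y - Q.center b) j ∈
      Ico (-(r / 2 * 2 ^ Q.level)) (r / 2 * 2 ^ Q.level) := by
  refine forall_congr' fun j => ?_
  rw [map_sub, PiLp.sub_apply, repr_center, mem_Ico, mem_Ico, sub_lt_iff_lt_add, le_sub_iff_add_le]
  constructor <;> rintro ⟨h1, h2⟩ <;> constructor <;> linarith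

/-- A homothety maps a cell into a given multiple of any other cell. -/
lemma center_add_smul_mem {Q Q' : Cell n} {r r' : ℝ} (hr : 0 < r) (hr' : 0 < r') {y : V}
    (hy : y ∈ Q.scaled b r) :
    Q'.center b + ((r' * 2 ^ Q'.level) / (r * 2 ^ Q.level)) • (y - Q.center b) ∈
      Q'.scaled b r' := by
  rw [mem_scaled_iff] at hy ⊢
  intro j
  have h := hy j
  have h0 := two_zpow_pos Q.level
  have h0' := two_zpow_pos Q'.level
  set s := (r' * (2 : ℝ) ^ Q'.level) / (r * 2 ^ Q.level) with hs
  have hs0 : 0 < s := by positivity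
  have hval : r' / 2 * (2 : ℝ) ^ Q'.level = s * (r / 2 * 2 ^ Q.level) := by
    rw [hs]; field_simp
  rw [add_sub_cancel_left, map_smul, PiLp.smul_apply, smul_eq_mul, hval]
  constructor
  · have := mul_le_mul_of_nonneg_left h.1 hs0.le
    linarith
  · exact mul_lt_mul_of_pos_left h.2 hs0

lemma center_mem_scaled (Q : Cell n) {r : ℝ} (hr : 0 < r) : Q.center b ∈ Q.scaled b r := by
  rw [mem_scaled_iff]
  intro j
  have h0 := two_zpow_pos Q.level
  rw [sub_self, map_zero, PiLp.zero_apply]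
  constructor
  · have : 0 < r / 2 * 2 ^ Q.level := by positivity
    linarith
  · positivity

lemma dist_le_of_mem_toSet {Q : Cell n} {y z : V} (hy : y ∈ Q.toSet b) (hz : z ∈ Q.toSet b) :
    dist y z ≤ n * 2 ^ Q.level := by
  rw [mem_toSet] at hy hz
  rw [dist_eq_norm, ← b.sum_repr (y - z)]
  refine (norm_sum_le _ _).trans ((Finset.sum_le_card_nsmul _ _ (2 ^ Q.level) ?_).trans_eq
    (by simp))
  intro j _
  rw [norm_smul, b.norm_eq_one, mul_one, Real.norm_eq_abs, map_sub, PiLp.sub_apply, abs_le]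
  have h1 := hy j
  have h2 := hz j
  rw [mem_Ico] at h1 h2
  constructor <;> linarith

lemma isBounded_toSet (Q : Cell n) : Bornology.IsBounded (Q.toSet b) :=
  isBounded_iff.2 ⟨_, fun _ hy _ hz => dist_le_of_mem_toSet b hy hz⟩

lemma dist_le_diam {Q : Cell n} {y z : V} (hy : y ∈ Q.toSet b) (hz : z ∈ Q.toSet b) :
    dist y z ≤ Q.diam b :=
  dist_le_diam_of_mem (isBounded_toSet b Q) hy hz

lemma diam_le (Q : Cell n) : Q.diam b ≤ n * 2 ^ Q.level :=
  diam_le_of_forall_dist_le (by have := two_zpow_pos Q.level; positivity)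
    fun _ hy _ hz => dist_le_of_mem_toSet b hy hz

lemma le_diam (hn : 1 ≤ n) (Q : Cell n) : 2 ^ Q.level / 4 ≤ Q.diam b := by
  classical
  have h0 := two_zpow_pos Q.level
  have hmem : Q.center b + ((2 : ℝ) ^ Q.level / 4) • b ⟨0, hn⟩ ∈ Q.toSet b := by
    rw [toSet, mem_scaled_iff]
    intro j
    rw [add_sub_cancel_left, map_smul, b.repr_self, PiLp.smul_apply, smul_eq_mul,
      PiLp.single_apply]
    split_ifs <;> constructor <;> linarith
  have := dist_le_diam b hmem (center_mem_scaled b Q one_pos)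
  rw [dist_eq_norm, add_sub_cancel_left, norm_smul, b.norm_eq_one, mul_one, Real.norm_eq_abs,
    abs_of_pos (by positivity)] at this
  exact this

lemma diam_pos (hn : 1 ≤ n) (Q : Cell n) : 0 < Q.diam b :=
  (by have := two_zpow_pos Q.level; positivity : (0 : ℝ) < 2 ^ Q.level / 4).trans_le
    (le_diam b hn Q)

/-- The diameters of dyadic cells are proportional to their side lengths. -/
lemma diam_mul_zpow_le (Q Q' : Cell n) :
    Q.diam b * 2 ^ Q'.level ≤ Q'.diam b * 2 ^ Q.level := by
  have h0 := two_zpow_pos Q.level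
  have h0' := two_zpow_pos Q'.level
  rw [← le_div_iff₀ h0']
  refine diam_le_of_forall_dist_le (div_nonneg (mul_nonneg diam_nonneg h0.le) h0'.le)
    fun y hy z hz => ?_
  have hy' := center_add_smul_mem b (Q' := Q') one_pos one_pos hy
  have hz' := center_add_smul_mem b (Q' := Q') one_pos one_pos hz
  have h := dist_le_diam b hy' hz'
  rw [dist_add_left, dist_eq_norm, ← smul_sub, norm_smul, sub_sub_sub_cancel_right, ← dist_eq_norm,
    one_mul, one_mul, Real.norm_eq_abs, abs_of_pos (by positivity), div_mul_eq_mul_div,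
    div_le_iff₀ h0] at h
  rw [le_div_iff₀ h0']
  linarith

lemma level_le_of_diam_le (hn : 1 ≤ n) {Q Q' : Cell n} (h : Q.diam b ≤ Q'.diam b) :
    Q.level ≤ Q'.level := by
  have h1 := diam_mul_zpow_le b Q' Q
  have hd := diam_pos b hn Q
  have h0 := two_zpow_pos Q'.level
  have h2 : (2 : ℝ) ^ Q.level ≤ 2 ^ Q'.level := by
    have h3 : Q.diam b * 2 ^ Q.level ≤ Q.diam b * 2 ^ Q'.level :=
      (mul_le_mul_of_nonneg_right h (two_zpow_pos Q.level).le).trans h1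
    exact le_of_mul_le_mul_left h3 hd
  exact (zpow_le_zpow_iff_right₀ one_lt_two).1 h2

lemma dist_le_of_mem_scaled {Q : Cell n} {a z : V} (ha : a ∈ Q.scaled b 3)
    (hz : z ∈ Q.toSet b) : dist a z ≤ 4 * Q.diam b := by
  have h0 := two_zpow_pos Q.level
  have hc := center_mem_scaled b Q one_pos
  have h1 := dist_le_diam b (center_add_smul_mem b (Q' := Q) three_pos one_pos ha) hc
  have h2 := dist_le_diam b hc hz
  have h3 : (1 * (2 : ℝ) ^ Q.level) / (3 * 2 ^ Q.level) = 1 / 3 := by field_simp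
  rw [h3, dist_eq_norm, add_sub_cancel_left, norm_smul, ← dist_eq_norm, Real.norm_eq_abs,
    abs_of_pos (by norm_num)] at h1
  have := dist_triangle a (Q.center b) z
  linarith

instance : Countable (Cell n) :=
  Function.Injective.countable (f := fun Q : Cell n => (Q.level, Q.pos)) (by
    rintro ⟨l, p⟩ ⟨l', p'⟩ h
    simpa [Prod.ext_iff] using h)

/-- The sum of the volumes of disjoint cells in a bounded region is bounded. -/
lemma tsum_volume_le {I : Set (Cell n)} {R : ℝ}
    (hdisj : ∀ Q ∈ I, ∀ Q' ∈ I, ∀ w, w ∈ Q.toSet b → w ∈ Q'.toSet b → Q = Q')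
    (hR : ∀ Q ∈ I, ∀ w ∈ Q.toSet b, ‖w‖ < R) :
    ∑' Q : I, ENNReal.ofReal ((2 : ℝ) ^ Q.1.level) ^ n ≤ ENNReal.ofReal (2 * R) ^ n := by
  set cube : Cell n → Set (Fin n → ℝ) := fun Q => Set.univ.pi fun j =>
    Ico ((Q.pos j : ℝ) * 2 ^ Q.level) (((Q.pos j : ℝ) + 1) * 2 ^ Q.level) with hcube
  have hmem : ∀ (Q : Cell n) (y : Fin n → ℝ), y ∈ cube Q →
      b.repr.symm (WithLp.toLp 2 y) ∈ Q.toSet b := by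
    intro Q y hy
    rw [mem_toSet]
    intro j
    simpa using hy j (mem_univ j)
  have hvol : ∀ Q : Cell n, volume (cube Q) = ENNReal.ofReal ((2 : ℝ) ^ Q.level) ^ n := by
    intro Q
    rw [hcube, Real.volume_pi_Ico]
    have : ∀ j, ((Q.pos j : ℝ) + 1) * 2 ^ Q.level - Q.pos j * 2 ^ Q.level = 2 ^ Q.level :=
      fun j => by ring
    simp [this]
  have h1 := tsum_meas_le_meas_iUnion_of_disjoint (volume : Measure (Fin n → ℝ))
    (As := fun Q : I => cube Q.1)
    (fun Q => MeasurableSet.univ_pi fun j => measurableSet_Ico) (by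
      intro Q Q' hne
      refine Set.disjoint_left.2 fun y hy hy' => hne (Subtype.ext ?_)
      exact hdisj _ Q.2 _ Q'.2 _ (hmem _ y hy) (hmem _ y hy'))
  simp only [hvol] at h1
  refine h1.trans ((measure_mono (t := Set.univ.pi fun _ => Ico (-R) R) ?_).trans ?_)
  · refine iUnion_subset fun Q y hy j _ => ?_
    have h2 := hR _ Q.2 _ (hmem _ y hy)
    rw [LinearIsometryEquiv.norm_map] at h2
    have h3 : |y j| < R := (PiLp.norm_apply_le (WithLp.toLp 2 y) j).trans_lt h2
    exact ⟨(abs_lt.1 h3).1.le, (abs_lt.1 h3).2⟩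
  · rw [Real.volume_pi_Ico]
    simp [sub_neg_eq_add, two_mul]

end Cell

namespace Config

variable {n N : ℕ} {c : Config n N} {C₀ : ℝ}

/-! ### The functions `d` and `D` -/

lemma S_nonneg {q : Euc N × ℝ} (hq : q ∈ c.S) : 0 < q.2 := hq.1.2.1.1

lemma bddBelow_d (x : Euc N) :
    BddBelow ((fun q : Euc N × ℝ => dist q.1 x + q.2) '' c.S) :=
  ⟨0, by rintro _ ⟨q, hq, rfl⟩; exact add_nonneg dist_nonneg (S_nonneg hq).le⟩

lemma d_nonneg (x : Euc N) : 0 ≤ c.d x :=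
  Real.sInf_nonneg (by rintro _ ⟨q, hq, rfl⟩; exact add_nonneg dist_nonneg (S_nonneg hq).le)

lemma d_le {q : Euc N × ℝ} (hq : q ∈ c.S) (x : Euc N) : c.d x ≤ dist q.1 x + q.2 :=
  csInf_le (bddBelow_d x) ⟨q, hq, rfl⟩

lemma d_le_add_dist (hS : c.S.Nonempty) (x y : Euc N) : c.d x ≤ c.d y + dist x y := by
  rw [← sub_le_iff_le_add]
  refine le_csInf (hS.image _) ?_
  rintro _ ⟨q, hq, rfl⟩
  have h1 := d_le hq x
  have h2 := dist_triangle_right q.1 x y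
  have h3 := dist_triangle q.1 y x
  rw [dist_comm y x] at h3
  dsimp only
  linarith

lemma bddBelow_D (y : c.P₀) : BddBelow (c.d '' (c.proj ⁻¹' {y})) :=
  ⟨0, by rintro _ ⟨x, -, rfl⟩; exact d_nonneg x⟩

lemma D_nonneg (y : c.P₀) : 0 ≤ c.D y :=
  Real.sInf_nonneg (by rintro _ ⟨x, -, rfl⟩; exact d_nonneg x)

lemma D_proj_le (x : Euc N) : c.D (c.proj x) ≤ c.d x :=
  csInf_le (bddBelow_D _) ⟨x, rfl, rfl⟩

lemma proj_coe (y : c.P₀) : c.proj (y : Euc N) = y :=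
  Submodule.orthogonalProjectionOnto_mem_subspace_eq_self y

lemma D_le_add_dist (hS : c.S.Nonempty) (y z : c.P₀) : c.D y ≤ c.D z + dist y z := by
  rw [← sub_le_iff_le_add]
  refine le_csInf ⟨_, (z : Euc N), proj_coe z, rfl⟩ ?_
  rintro _ ⟨x, hx, rfl⟩
  have hx : c.proj x = z := hx
  have h1 : c.proj (x + ((y - z : c.P₀) : Euc N)) = y := by
    have h2 : c.proj (x + ((y - z : c.P₀) : Euc N)) = c.proj x + c.proj ((y - z : c.P₀) : Euc N) :=
      map_add c.P₀.orthogonalProjectionOnto _ _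
    rw [h2, proj_coe, hx]
    abel
  have h2 := D_proj_le (c := c) (x + ((y - z : c.P₀) : Euc N))
  have h3 := d_le_add_dist hS (x + ((y - z : c.P₀) : Euc N)) x
  rw [h1] at h2
  rw [dist_eq_norm, add_sub_cancel_left] at h3
  have h4 : ‖((y - z : c.P₀) : Euc N)‖ = dist y z := by rw [dist_eq_norm]; rfl
  linarith

/-! ### The Whitney family -/

variable (b : OrthonormalBasis (Fin n) ℝ c.P₀)

lemma SmallCell.diam_le {Q : Cell n} (h : c.SmallCell b Q) {a : c.P₀} (ha : a ∈ Q.toSet b) :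
    20 * Q.diam b ≤ c.D a := by
  have h1 : sInf (c.D '' Q.toSet b) ≤ c.D a :=
    csInf_le ⟨0, by rintro _ ⟨y, -, rfl⟩; exact D_nonneg y⟩ ⟨a, ha, rfl⟩
  have h2 : Q.diam b ≤ 1 / 20 * sInf (c.D '' Q.toSet b) := h
  linarith

/-- The cells of the Whitney family are disjoint. -/
lemma eq_of_mem_I (hn : 1 ≤ n) {Q Q' : Cell n} (hQ : Q ∈ c.I b) (hQ' : Q' ∈ c.I b) {w : c.P₀}
    (hw : w ∈ Q.toSet b) (hw' : w ∈ Q'.toSet b) : Q = Q' := by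
  have key : ∀ {Q Q' : Cell n}, Q ∈ c.I b → Q' ∈ c.I b → w ∈ Q.toSet b → w ∈ Q'.toSet b →
      Q.level ≤ Q'.level → Q = Q' := by
    rintro Q Q' ⟨z, hz, -, -, hmax⟩ ⟨-, -, -, hsmall, -⟩ hw hw' hl
    have hz' := Cell.toSet_subset_of_level_le b hl hw hw' hz
    have h1 := Cell.level_le_of_diam_le b hn (hmax Q' hz' hsmall)
    rw [Cell.eq_cellAt b hw, Cell.eq_cellAt b hw', le_antisymm hl h1]
  rcases le_total Q.level Q'.level with h | h
  · exact key hQ hQ' hw hw' h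
  · exact (key hQ' hQ hw' hw h).symm

/-- The Whitney family covers the set where `D` is positive. -/
lemma exists_mem_I (hn : 1 ≤ n) (hS : c.S.Nonempty) {z : c.P₀} (hz : 0 < c.D z) :
    ∃ Q ∈ c.I b, z ∈ Q.toSet b := by
  have hn0 : (0 : ℝ) < n := by exact_mod_cast hn
  -- Small cells at `z` are admissible, and the diameter of an admissible one is at most `D z / 20`.
  obtain ⟨m, hm⟩ := exists_pow_lt_of_lt_one (div_pos hz (by positivity : (0 : ℝ) < 21 * n))
    (by norm_num : (1 / 2 : ℝ) < 1)
  obtain ⟨M, hM⟩ := pow_unbounded_of_one_lt (c.D z) (one_lt_two : (1 : ℝ) < 2)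
  obtain ⟨l, hl, hmax⟩ := Int.exists_greatest_of_bdd
    (P := fun l => c.SmallCell b (Cell.cellAt b l z)) ⟨M, fun l hl => by
      have h1 := hl.diam_le b (Cell.mem_cellAt b l z)
      have h2 := Cell.le_diam b hn (Cell.cellAt b l z)
      have h3 : (2 : ℝ) ^ l / 4 ≤ (Cell.cellAt b l z).diam b := h2
      have h4 := Cell.two_zpow_pos l
      have h5 : (2 : ℝ) ^ l ≤ 2 ^ (M : ℤ) := by rw [zpow_natCast]; linarith
      exact (zpow_le_zpow_iff_right₀ one_lt_two).1 h5⟩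
    ⟨-m, by
      set Q := Cell.cellAt b (-m) z
      have hlev : (2 : ℝ) ^ Q.level = (1 / 2) ^ m := by
        change (2 : ℝ) ^ (-(m : ℤ)) = _
        rw [zpow_neg, zpow_natCast, one_div, inv_pow]
      rw [lt_div_iff₀ (by positivity)] at hm
      have h1 : c.D z - n * 2 ^ Q.level ≤ sInf (c.D '' Q.toSet b) := by
        refine le_csInf ⟨_, z, Cell.mem_cellAt b _ z, rfl⟩ ?_
        rintro _ ⟨a, ha, rfl⟩
        have h2 := D_le_add_dist hS z a
        have h3 := Cell.dist_le_of_mem_toSet b (Cell.mem_cellAt b (-m) z) ha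
        have h3 : dist z a ≤ n * 2 ^ Q.level := h3
        linarith
      have h4 := Cell.diam_le b Q
      rw [hlev] at h1 h4
      change Q.diam b ≤ 1 / 20 * sInf (c.D '' Q.toSet b)
      linarith⟩
  refine ⟨_, ⟨z, Cell.mem_cellAt b l z, hz, hl, fun Q' hQ' hs => ?_⟩, Cell.mem_cellAt b l z⟩
  have h1 : Q'.level ≤ l := hmax _ (by rwa [← Cell.eq_cellAt b hQ'])
  have hsub := Cell.toSet_subset_of_level_le b (Q' := Cell.cellAt b l z) h1 hQ'
    (Cell.mem_cellAt b l z)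
  exact diam_mono hsub (Cell.isBounded_toSet b _)

lemma diam_le_of_mem_scaled (hS : c.S.Nonempty) {Q : Cell n} (hQ : Q ∈ c.I b) {a : c.P₀}
    (ha : a ∈ Q.scaled b 3) : 16 * Q.diam b ≤ c.D a := by
  obtain ⟨z, hz, -, hs, -⟩ := hQ
  have h1 := hs.diam_le b hz
  have h2 := D_le_add_dist hS z a
  have h3 := Cell.dist_le_of_mem_scaled b ha hz
  rw [dist_comm] at h3
  linarith

end Config

namespace Config.Choices

variable {n N : ℕ} {c : Config n N} {C₀ : ℝ} {ch : c.Choices}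

lemma S_nonempty (ch : c.Choices) : c.S.Nonempty := by
  classical
  by_cases h0 : (0 : c.P₀) ∈ c.proj '' c.Z
  · obtain ⟨X, hX, -⟩ := h0
    exact ⟨(X, 1), mem_Stotal_of_h_le hX.1 one_pos (by norm_num) (by rw [hX.2]; norm_num),
      by rw [hX.2]; norm_num⟩
  · by_contra hS
    have hempty : c.I12 ch.basis = ∅ := by
      rw [eq_empty_iff_forall_notMem]
      exact fun i hi => hS ⟨_, ch.mem_S i hi⟩
    have h1 := ch.sum_eq_one 0 ⟨by simp [U12], h0⟩
    simp [hempty] at h1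

variable {i : Cell n}

lemma t_pos (hi : i ∈ c.I12 ch.basis) : 0 < ch.t i := S_nonneg (ch.mem_S i hi)

lemma diam_le_t (hi : i ∈ c.I12 ch.basis) : i.diam ch.basis ≤ 2 * ch.t i :=
  (ch.diam_le i hi).trans (diam_closedBall (t_pos hi).le)

lemma t_le_diam (hN : 1 ≤ N) (hi : i ∈ c.I12 ch.basis) : ch.t i ≤ 100 * i.diam ch.basis := by
  have : NeZero N := ⟨by omega⟩
  have h := ch.le_diam i hi
  rw [diam_closedBall_eq _ (t_pos hi).le] at h
  linarith

lemma dist_proj_X_le (hn : 1 ≤ n) (hi : i ∈ c.I12 ch.basis) {a : c.P₀}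
    (ha : a ∈ i.scaled ch.basis 3) :
    dist (c.proj (ch.X i)) a ≤ ch.t i + 105 * i.diam ch.basis := by
  have hd := Cell.diam_pos ch.basis hn i
  have hlt := (ch.dist_le i hi).trans_lt
    (by linarith : 100 * i.diam ch.basis < 101 * i.diam ch.basis)
  obtain ⟨_, ⟨_, ⟨u, hu, rfl⟩, z, hz, rfl⟩, hlt⟩ := exists_lt_of_csInf_lt
    (by
      exact ⟨_, _, ⟨ch.X i, mem_closedBall_self (t_pos hi).le, rfl⟩, i.center ch.basis,
        Cell.center_mem_scaled ch.basis i one_pos, rfl⟩) hlt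
  have h1 := dist_triangle4 (c.proj (ch.X i)) (c.proj u) z a
  have h2 := c.dist_proj_le (ch.X i) u
  have h3 := Cell.dist_le_of_mem_scaled ch.basis ha hz
  rw [mem_closedBall, dist_comm] at hu
  rw [dist_comm] at h3
  linarith

/-- Balls attached to cells whose triples meet have comparable radii. -/
lemma t_le_t (hn : 1 ≤ n) (hN : 1 ≤ N) {j : Cell n} (hi : i ∈ c.I12 ch.basis)
    (hj : j ∈ c.I12 ch.basis) {a : c.P₀} (hai : a ∈ i.scaled ch.basis 3)
    (haj : a ∈ j.scaled ch.basis 3) : ch.t i ≤ 4000 * ch.t j := by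
  have h1 := diam_le_of_mem_scaled ch.basis ch.S_nonempty hi.1 hai
  have h2 := D_le_add_dist ch.S_nonempty a (c.proj (ch.X j))
  have h3 := D_proj_le (c := c) (ch.X j)
  have h4 := d_le (ch.mem_S j hj) (ch.X j)
  have h5 := dist_proj_X_le hn hj haj
  have h6 := t_le_diam hN hi
  have h7 := diam_le_t hj
  have h8 := t_le_diam hN hj
  rw [dist_self] at h4
  rw [dist_comm] at h5
  dsimp only at h4
  linarith

/-- The Whitney cells near `U_12` are disjoint cells of a bounded region, so the radii of the
attached balls satisfy a packing bound. -/
lemma tsum_t_pow_le (hn : 1 ≤ n) (hN : 1 ≤ N) :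
    ∑' i : c.I12 ch.basis, ENNReal.ofReal (ch.t i ^ n) ≤
      ENNReal.ofReal ((100 * n * 226) ^ n) := by
  have h1 := Cell.tsum_volume_le ch.basis (I := c.I12 ch.basis) (R := 113)
    (fun Q hQ Q' hQ' w hw hw' => eq_of_mem_I ch.basis hn hQ.1 hQ'.1 hw hw')
    -- The cells meet `U_12` and have diameter at most `2 * 50`.
    (fun Q hQ w hw => by
      obtain ⟨a, haQ, haU⟩ := hQ.2
      have h2 : dist a 0 ≤ 12 := haU
      have h3 := Cell.dist_le_diam ch.basis hw haQ
      have h4 := diam_le_t hQ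
      have h5 : ch.t Q < 50 := (ch.mem_S Q hQ).1.2.1.2
      have h6 := dist_triangle w a 0
      rw [dist_zero_right] at h6
      linarith)
  calc _ ≤ ∑' i : c.I12 ch.basis, ENNReal.ofReal ((100 * n) ^ n) *
        ENNReal.ofReal ((2 : ℝ) ^ i.1.level) ^ n := by
        refine ENNReal.tsum_le_tsum fun i => ?_
        have h0 := Cell.two_zpow_pos i.1.level
        have h0' := t_pos i.2
        rw [← ENNReal.ofReal_pow h0.le, ← ENNReal.ofReal_mul (by positivity), ← mul_pow]
        apply ENNReal.ofReal_le_ofReal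
        gcongr
        have h2 := t_le_diam hN i.2
        have h3 := Cell.diam_le ch.basis i.1
        linarith
    _ = ENNReal.ofReal ((100 * n) ^ n) *
        ∑' i : c.I12 ch.basis, ENNReal.ofReal ((2 : ℝ) ^ i.1.level) ^ n := ENNReal.tsum_mul_left
    _ ≤ ENNReal.ofReal ((100 * n) ^ n) * ENNReal.ofReal (2 * 113) ^ n := by gcongr
    _ = _ := by
        rw [← ENNReal.ofReal_pow (by norm_num), ← ENNReal.ofReal_mul (by positivity), ← mul_pow]
        norm_num

/-! ### The exceptional sets -/

/-- Below a point of `G` there is a point `X` of the support which is good from a scale on that is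
small compared with the distance of the two points. -/
lemma exists_good_of_mem_G (hc : c.Regime C₀) {x : Euc N} (hx : x ∈ ch.G) :
    x ∈ c.F ∧ ∃ X ∈ c.F, 0 < dist x X ∧ c.h X ≤ dist x X / 60 ∧
      dist (c.proj x) (c.proj X) ≤ dist x X / 60 := by
  have hxFZ : x ∈ c.F \ c.Z := hx.elim (fun h => h.1) (fun h => h.1)
  refine ⟨hxFZ.1, ?_⟩
  by_cases hZ : c.proj x ∈ c.proj '' c.Z
  · obtain ⟨X, hX, hXx⟩ := hZ
    have hne : x ≠ X := fun h => hxFZ.2 (h ▸ hX)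
    have hpos := dist_pos.2 hne
    refine ⟨X, hX.1, hpos, ?_, ?_⟩
    · rw [hX.2]; positivity
    · rw [hXx, dist_self]; positivity
  have hG : ∀ i ∈ c.I12 ch.basis, c.proj x ∈ i.scaled ch.basis 3 →
      x ∉ closedBall (ch.X i) ((2 * (104 * 10 * 6 + 214)) * ch.t i) :=
    hx.elim (fun h => h.2) (fun h => absurd h.2 hZ)
  rcases (D_nonneg (c.proj x)).eq_or_lt with hD | hD
  · -- Otherwise points of the support with ever better scales would converge to `x`.
    by_contra hcon
    push Not at hcon
    refine hxFZ.2 ⟨hxFZ.1, h_eq_zero_of_approx fun ρ hρ => ?_⟩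
    obtain ⟨_, ⟨x', hx', rfl⟩, hdx'⟩ := exists_lt_of_csInf_lt
      (⟨_, x, rfl, rfl⟩ : (c.d '' (c.proj ⁻¹' {c.proj x})).Nonempty)
      (hD.symm.trans_lt (by positivity : 0 < ρ / 60))
    obtain ⟨_, ⟨q, hq, rfl⟩, hq'⟩ := exists_lt_of_csInf_lt (ch.S_nonempty.image _) hdx'
    have ht := S_nonneg hq
    have hqd : 0 ≤ dist q.1 x' := dist_nonneg
    dsimp only at hq'
    have hh : c.h q.1 < ρ / 60 := hq.2.trans_lt (by linarith)
    have hp : dist (c.proj x) (c.proj q.1) < ρ / 60 := by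
      have h1 := c.dist_proj_le q.1 x'
      have hx' : c.proj x' = c.proj x := hx'
      rw [hx', dist_comm] at h1
      linarith
    refine ⟨q.1, ?_, by linarith⟩
    rw [dist_comm]
    by_contra hge
    push Not at hge
    have := hcon q.1 hq.1.1 (by linarith) (by linarith)
    linarith
  · obtain ⟨i, hi, hxi⟩ := exists_mem_I ch.basis hc.one_le ch.S_nonempty hD
    have hU : c.proj x ∈ c.U12 := hc.proj_mem_U12 hxFZ.1
    have hi12 : i ∈ c.I12 ch.basis := ⟨hi, _, hxi, hU⟩
    have hx3 := Cell.toSet_subset_scaled ch.basis i hxi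
    have h1 := hG i hi12 hx3
    rw [mem_closedBall, not_le] at h1
    have ht := t_pos hi12
    have h2 := dist_proj_X_le hc.one_le hi12 hx3
    have h3 := diam_le_t hi12
    rw [dist_comm] at h2
    have hS := ch.mem_S i hi12
    have h4 : c.h (ch.X i) ≤ ch.t i := hS.2
    exact ⟨ch.X i, hS.1.1, by linarith, by linarith, by linarith⟩

/-- A point outside `G` with `π(x)` in the triple of a Whitney cell lies in a fixed multiple of
the ball attached to the cell. -/
lemma dist_X_le (hc : c.Regime C₀) (hN : 1 ≤ N) {x : Euc N} (hx : x ∈ c.F \ c.Z) (hxG : x ∉ ch.G)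
    {j : Cell n} (hj : j ∈ c.I12 ch.basis) (hxj : c.proj x ∈ j.scaled ch.basis 3) :
    dist x (ch.X j) ≤ 10 ^ 8 * ch.t j := by
  have h0 : ¬∀ i ∈ c.I12 ch.basis, c.proj x ∈ i.scaled ch.basis 3 →
      x ∉ closedBall (ch.X i) ((2 * (104 * 10 * 6 + 214)) * ch.t i) :=
    fun h => hxG (Or.inl ⟨hx, h⟩)
  push Not at h0
  obtain ⟨i, hi, hxi, hxB⟩ := h0
  rw [mem_closedBall] at hxB
  have hSi := ch.mem_S i hi
  have hSj := ch.mem_S j hj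
  -- The centres of the balls of `i` and `j` are close because their projections are.
  have h1 := hc.dist_le hSi.1.1 hSj.1.1 (t_pos hi) (t_pos hj) hSi.2 hSj.2
  dsimp only at h1
  have h2 := dist_proj_X_le hc.one_le hi hxi
  have h3 := dist_proj_X_le hc.one_le hj hxj
  have h4 := diam_le_t hi
  have h5 := diam_le_t hj
  have h6 := t_le_t hc.one_le hN hi hj hxi hxj
  have h7 := dist_triangle_right (c.proj (ch.X i)) (c.proj (ch.X j)) (c.proj x)
  have h8 := dist_triangle x (ch.X i) (ch.X j)
  have h9 := t_pos hj
  linarith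

lemma dist_Ai_le (hc : c.Regime C₀) {j : Cell n} (hj : j ∈ c.I12 ch.basis) (x : Euc N) :
    dist x ((c.proj x : Euc N) + (ch.Ai j (c.proj x) : Euc N)) ≤
      7 / 3 * infDist x (ch.plane (ch.X j) (ch.t j) : Set (Euc N)) := by
  have hP := ch.goodPlane _ (ch.mem_S j hj).1
  dsimp only at hP
  set P := ch.plane (ch.X j) (ch.t j) with hPdef
  have hang : angle P.direction c.P₀ ≤ 1 / 4 := hP.2.2.trans hc.α_le
  have hmem : (c.proj x : Euc N) + (ch.Ai j (c.proj x) : Euc N) ∈ P :=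
    Classical.epsilon_spec (exists_mem_of_angle_le hc.finrank_P₀ hP.1 hang (c.proj x))
  have h := dist_le_of_angle_le hP.1.1 hang x
    ((c.proj x : Euc N) + (ch.Ai j (c.proj x) : Euc N))
  have h0 : c.proj ((c.proj x : Euc N) + (ch.Ai j (c.proj x) : Euc N)) = c.proj x := by
    have h1 : c.proj ((c.proj x : Euc N) + (ch.Ai j (c.proj x) : Euc N)) =
        c.proj (c.proj x : Euc N) + c.proj (ch.Ai j (c.proj x) : Euc N) :=
      map_add c.P₀.orthogonalProjectionOnto _ _
    have h2 : c.proj (ch.Ai j (c.proj x) : Euc N) = 0 :=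
      Submodule.orthogonalProjectionOnto_eq_zero_iff.2 (ch.Ai j (c.proj x)).2
    rw [h1, h2, add_zero, proj_coe]
  rw [norm_starProjection_sub, h0, dist_self, infDist_zero_of_mem hmem] at h
  simpa using h

lemma proj_add_projPerp (x : Euc N) : (c.proj x : Euc N) + (c.projPerp x : Euc N) = x := by
  have := c.P₀.starProjection_add_starProjection_orthogonal x
  rwa [Submodule.starProjection_apply, Submodule.starProjection_apply] at this

/-- At a bad point outside `G` one of the planes that are averaged in the definition of `A` is
already far away. -/
lemma exists_far_plane (hc : c.Regime C₀) (hN : 1 ≤ N) {x : Euc N} (hx : x ∈ c.F \ ch.Ftilde)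
    (hxG : x ∉ ch.G) :
    ∃ j ∈ c.I12 ch.basis, x ∈ closedBall (ch.X j) (c.k * ch.t j) ∧
      √c.ε / 20 * ch.t j ≤ infDist x (ch.plane (ch.X j) (ch.t j) : Set (Euc N)) := by
  have hfar : √c.ε * c.d x < dist x ((c.proj x : Euc N) + (ch.A (c.proj x) : Euc N)) := by
    by_contra hle
    exact hx.2 ⟨⟨hx.1, hxG⟩, not_lt.1 hle⟩
  have hxZ : x ∉ c.Z := by
    intro hxZ
    have hmem : c.proj x ∈ c.proj '' c.Z := ⟨x, hxZ, rfl⟩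
    rw [A, if_pos hmem, (hc.injOn_proj).leftInvOn_invFunOn hxZ, proj_add_projPerp,
      dist_self] at hfar
    exact absurd hfar (not_lt.2 (mul_nonneg (Real.sqrt_nonneg _) (d_nonneg x)))
  have hxZ' : c.proj x ∉ c.proj '' c.Z := fun h => hxG (Or.inr ⟨⟨hx.1, hxZ⟩, h⟩)
  have hU : c.proj x ∈ c.U12 := hc.proj_mem_U12 hx.1
  set a := c.proj x with ha
  have hsum := ch.sum_eq_one a ⟨hU, hxZ'⟩
  rw [finsum_mem_def] at hsum
  set φ : Cell n → ℝ := (c.I12 ch.basis).indicator fun i => ch.φ i a with hφ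
  have hfin : φ.support.Finite := by
    by_contra hinf
    rw [finsum_of_infinite_support hinf] at hsum
    exact zero_ne_one hsum
  have hφ0 : ∀ i, 0 ≤ φ i := fun i =>
    Set.indicator_nonneg (fun i hi => ch.nonneg i hi a ⟨hU, hxZ'⟩) i
  have hA : ch.A a = ∑ i ∈ hfin.toFinset, φ i • ch.Ai i a := by
    rw [A, if_neg hxZ', finsum_mem_def]
    have h1 : (c.I12 ch.basis).indicator (fun i => ch.φ i a • ch.Ai i a) =
        fun i => φ i • ch.Ai i a := by
      funext i
      by_cases hi : i ∈ c.I12 ch.basis <;> simp [hφ, hi]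
    rw [h1]
    refine finsum_eq_sum_of_support_subset _ fun i hi => ?_
    simp only [Finite.coe_toFinset, Function.mem_support] at hi ⊢
    exact fun h => hi (by rw [h, zero_smul])
  rw [finsum_eq_sum _ hfin] at hsum
  -- By convexity the distance to the average is at most the largest distance.
  obtain ⟨j, hjs, hj⟩ : ∃ j ∈ hfin.toFinset,
      √c.ε * c.d x < dist x ((a : Euc N) + (ch.Ai j a : Euc N)) := by
    by_contra hcon
    push Not at hcon
    refine absurd hfar (not_lt.2 ?_)
    have h1 : x - ((a : Euc N) + (ch.A a : Euc N)) =
        ∑ i ∈ hfin.toFinset, φ i • (x - ((a : Euc N) + (ch.Ai i a : Euc N))) := by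
      simp only [smul_sub, smul_add, Finset.sum_sub_distrib, Finset.sum_add_distrib,
        ← Finset.sum_smul, hsum, one_smul, hA]
      simp
    rw [dist_eq_norm, h1]
    calc _ ≤ ∑ i ∈ hfin.toFinset, ‖φ i • (x - ((a : Euc N) + (ch.Ai i a : Euc N)))‖ :=
          norm_sum_le _ _
      _ ≤ ∑ i ∈ hfin.toFinset, φ i * (√c.ε * c.d x) := by
          refine Finset.sum_le_sum fun i hi => ?_
          rw [norm_smul, Real.norm_of_nonneg (hφ0 i), ← dist_eq_norm]
          exact mul_le_mul_of_nonneg_left (hcon i hi) (hφ0 i)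
      _ = _ := by rw [← Finset.sum_mul, hsum, one_mul]
  -- The weight of `j` is nonzero, so `π(x)` lies in the triple of the cell `j`.
  have hjφ : φ j ≠ 0 := by simpa using hjs
  have hjI : j ∈ c.I12 ch.basis := by
    by_contra hn
    exact hjφ (Set.indicator_of_notMem hn _)
  have hj3 : a ∈ j.scaled ch.basis 3 := by
    by_contra hn
    refine hjφ ?_
    rw [hφ, Set.indicator_of_mem hjI]
    exact ch.eq_zero j hjI a ⟨hU, hxZ'⟩ hn
  have htj := t_pos hjI
  refine ⟨j, hjI, ?_, ?_⟩
  · rw [mem_closedBall]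
    refine (dist_X_le hc hN ⟨hx.1, hxZ⟩ hxG hjI hj3).trans ?_
    have := hc.le_k
    gcongr
  · have h1 := dist_Ai_le hc hjI x
    have h2 := diam_le_of_mem_scaled ch.basis ch.S_nonempty hjI.1 hj3
    have h3 := D_proj_le (c := c) x
    have h4 := t_le_diam hN hjI
    have h5 : √c.ε * (16 / 100 * ch.t j) ≤ √c.ε * c.d x := by
      gcongr
      linarith
    have h6 : 0 ≤ √c.ε * ch.t j := by positivity
    have h7 := hj.trans_le h1
    linarith

/-- The bad points outside `G` are covered by the sets where Chebyshev's inequality applies to one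
of the planes `P_j`. -/
lemma measure_bad_le (hc : c.Regime C₀) (hN : 1 ≤ N) :
    c.μ ((c.F \ ch.Ftilde) \ ch.G) ≤ ENNReal.ofReal (40 * √c.ε * (100 * n * 226) ^ n) := by
  have hsq : 0 < √c.ε := Real.sqrt_pos.2 hc.ε_pos
  set B : Cell n → Set (Euc N) := fun j => {x ∈ closedBall (ch.X j) (c.k * ch.t j) |
    √c.ε / 20 * ch.t j ≤ infDist x (ch.plane (ch.X j) (ch.t j) : Set (Euc N))}
  have hsub : (c.F \ ch.Ftilde) \ ch.G ⊆ ⋃ j ∈ c.I12 ch.basis, B j := by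
    rintro x ⟨hx, hxG⟩
    obtain ⟨j, hj, h1, h2⟩ := exists_far_plane hc hN hx hxG
    exact mem_biUnion hj ⟨h1, h2⟩
  calc _ ≤ ∑' j : c.I12 ch.basis, c.μ (B j) :=
        (measure_mono hsub).trans (measure_biUnion_le _ (Set.to_countable _) _)
    _ ≤ ∑' j : c.I12 ch.basis, ENNReal.ofReal (40 * √c.ε) * ENNReal.ofReal (ch.t j ^ n) := by
        refine ENNReal.tsum_le_tsum fun j => ?_
        have htj := t_pos j.2
        refine ((ch.goodPlane _ (ch.mem_S j j.2).1).measure_le hc.ε_pos.le htj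
          (κ := √c.ε / 20) (by positivity) (E := B j) (fun x hx => hx.1)
          (fun x hx => hx.2)).trans_eq ?_
        rw [← ENNReal.ofReal_mul (by positivity)]
        congr 2
        have h1 : √c.ε * √c.ε = c.ε := Real.mul_self_sqrt hc.ε_pos.le
        rw [div_eq_iff (by positivity)]
        linarith
    _ = ENNReal.ofReal (40 * √c.ε) * ∑' j : c.I12 ch.basis, ENNReal.ofReal (ch.t j ^ n) :=
        ENNReal.tsum_mul_left
    _ ≤ ENNReal.ofReal (40 * √c.ε) * ENNReal.ofReal ((100 * n * 226) ^ n) := by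
        gcongr
        exact tsum_t_pow_le hc.one_le hN
    _ = _ := by rw [← ENNReal.ofReal_mul (by positivity)]

end Config.Choices

end MengerGraph

namespace MengerGraph

/-! ### The estimate for the measure -/

/-- Zero is no Besicovitch constant, so `δ` is positive rather than the junk value of a division
by zero. -/
lemma IsBesicovitchConst.pos {N m : ℕ} (h : IsBesicovitchConst N m) : 0 < m := by
  rcases Nat.eq_zero_or_pos m with rfl | hm
  · obtain ⟨𝓑, -, h2⟩ := h {(0, 1)} (by simp) ⟨1, by simp⟩
    have := h2 ⟨(0, 1), rfl, rfl⟩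
    simp at this
  · exact hm

lemma Config.Standing.isFiniteMeasure {n N : ℕ} {c : Config n N} {p C₀ η : ℝ}
    {𝓚 : (Fin (n + 2) → Euc N) → ℝ≥0} (h : c.Standing p 𝓚 C₀ η) : IsFiniteMeasure c.μ := by
  refine ⟨?_⟩
  rw [← measure_add_measure_compl (isClosed_closedBall.measurableSet :
    MeasurableSet (closedBall (0 : Euc N) 5)), h.measure_compl, add_zero]
  exact (h.upper_regular 0 5 (by norm_num)).trans_lt ENNReal.ofReal_lt_top

end MengerGraph

theorem mainTheorem7 :
    ∃ kt : ℝ, 4 ≤ kt ∧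
      ∀ (n N : ℕ), 1 ≤ n → n < N → ∀ C₀ : ℝ, 10 ≤ C₀ →
      ∀ N₀ : ℕ, MengerGraph.IsBesicovitchConst N N₀ →
        ∃ εh : ℝ, 0 < εh ∧ εh ≤ 1 / 4 ∧
          ∀ p : ℝ, 1 < p → ∀ 𝓚 : (Fin (n + 2) → MengerGraph.Euc N) → NNReal,
            ∃ C₅ : ℝ,
              ∀ (c : MengerGraph.Config n N) (η : ℝ), c.N₀ = N₀ →
                c.Standing p 𝓚 C₀ η →
                0 < c.α → c.α ≤ 1 / 4 → η < 2 * εh → kt ≤ c.k →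
                η / 2 ≤ c.ε → c.ε < εh →
                ∀ ch : c.Choices,
                  c.μ (c.F \ ch.Ftilde) ≤ ENNReal.ofReal (C₅ * √c.ε) := by
  refine ⟨10 ^ 8, by norm_num, fun n N hn hN C₀ hC₀ N₀ hN₀ => ?_⟩
  set δ : ℝ := min ((10 : ℝ)⁻¹ ^ 10 / (600 ^ n * N₀)) (2 / 50 ^ n) with hδdef
  have hN₀' : (0 : ℝ) < N₀ := by exact_mod_cast hN₀.pos
  have hδ : 0 < δ := lt_min (by positivity) (by positivity)
  obtain ⟨c₁, r, m, hsel⟩ := MengerGraph.exists_isSelectionConst N n (C := C₀) (lam := δ / 2)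
    (by linarith) (by positivity)
  have hc₁ := hsel.c_pos
  have hm := hsel.m_pos
  -- Vertices within `κ * T` of a plane keep the points of the simplex near it within `T / 100`.
  set κ : ℝ := 1 / (100 * (n + 1) * (1 + 4 / c₁)) with hκdef
  have hκ : 0 < κ := by positivity
  have hκ' : (n + 1) * ((1 + 4 / c₁) * κ) ≤ 1 / 100 := by
    rw [hκdef]
    exact le_of_eq (by field_simp)
  set εh : ℝ := min (1 / 4) (min (δ / 2 * (1 / 60) ^ n / 200) (κ * m / 4)) with hεh
  refine ⟨εh, lt_min (by norm_num) (lt_min (by positivity) (by positivity)), min_le_left _ _, ?_⟩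
  intro p hp 𝓚
  -- The constants of the lower bound for `𝓚` do not depend on the measure.
  by_cases hLB : ∃ C l : ℝ, 1 ≤ C ∧ MengerGraph.HasLowerBound p 𝓚 C l
  swap
  · refine ⟨0, fun c η _ hst => ?_⟩
    obtain ⟨C, l, hC, -, h⟩ := hst.proper.lower_bound
    exact absurd ⟨C, l, hC, h⟩ hLB
  obtain ⟨C, l, hC, hLB⟩ := hLB
  set a : ℝ := (1 / 10) ^ p / (C * max 2 (1 / c₁) ^ l) * (m / 2) ^ (n + 1) with ha
  have ha0 : 0 < a := by
    have h1 : (0 : ℝ) < (1 / 10) ^ p := Real.rpow_pos_of_pos (by norm_num) p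
    have h2 : (0 : ℝ) < max 2 (1 / c₁) ^ l :=
      Real.rpow_pos_of_pos (lt_max_of_lt_left two_pos) l
    positivity
  refine ⟨40 * (100 * n * 226) ^ n + 2 / a, fun c η hcN₀ hst _ hα' _ hk hηε hε ch => ?_⟩
  have hcδ : c.δ = δ := by rw [MengerGraph.Config.δ, hcN₀]
  have hη := hst.η_pos
  have hε0 : 0 < c.ε := by linarith
  have hε1 : c.ε < 1 / 4 := hε.trans_le (min_le_left _ _)
  have hε2 : c.ε < δ / 2 * (1 / 60) ^ n / 200 :=
    hε.trans_le ((min_le_right _ _).trans (min_le_left _ _))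
  have hε3 : c.ε < κ * m / 4 := hε.trans_le ((min_le_right _ _).trans (min_le_right _ _))
  have hc : c.Regime C₀ :=
    { one_le := hn
      finrank_P₀ := hst.finrank_P₀
      finite := hst.isFiniteMeasure
      F_subset := Measure.support_subset_of_isClosed isClosed_closedBall
        (mem_ae_iff.2 hst.measure_compl)
      upper_regular := hst.upper_regular
      δ_pos := hcδ ▸ hδ
      α_le := hα'
      le_k := hk
      ε_pos := hε0
      ε_lt := by rw [hcδ]; linarith }
  have hfin := hst.isFiniteMeasure
  have hG : c.μ ch.G ≤ ENNReal.ofReal (η / a) := by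
    refine MengerGraph.measure_le_of_le_lintegral hst.proper.aemeasurable hst.curvature_le ha0
      fun x hx => ?_
    obtain ⟨hxF, X, hX, hpos, hh, hproj⟩ :=
      MengerGraph.Config.Choices.exists_good_of_mem_G hc hx
    exact hc.le_lintegral (hcδ.symm ▸ hsel) hκ hκ'
      (by rw [div_le_iff₀ hκ]; linarith) hxF hX rfl hpos hh hproj (by linarith) hC hLB
  have hsq : c.ε ≤ √c.ε := by
    rw [Real.le_sqrt' hε0]
    nlinarith
  have hηa : η / a ≤ 2 / a * √c.ε := by
    rw [div_mul_eq_mul_div]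
    gcongr
    linarith
  calc c.μ (c.F \ ch.Ftilde)
      ≤ c.μ ((c.F \ ch.Ftilde) \ ch.G) + c.μ ch.G := by
        refine (measure_mono fun x hx => ?_).trans (measure_union_le _ _)
        by_cases hxG : x ∈ ch.G
        · exact Or.inr hxG
        · exact Or.inl ⟨hx, hxG⟩
    _ ≤ ENNReal.ofReal (40 * √c.ε * (100 * n * 226) ^ n) + ENNReal.ofReal (η / a) :=
        add_le_add (MengerGraph.Config.Choices.measure_bad_le hc (by omega)) hG
    _ = ENNReal.ofReal (40 * √c.ε * (100 * n * 226) ^ n + η / a) :=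
        (ENNReal.ofReal_add (by positivity) (by positivity)).symm
    _ ≤ _ := by
        apply ENNReal.ofReal_le_ofReal
        linarith
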